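/- Let $K$ be a field of characteristic different from $2$. Let $A=A_0\oplus A_1$ be a Hopf superalgebra over $K$, with comultiplication $\delta$ (so $\delta:A\to A\otimes A$ and the counit are morphisms of superalgebras, where $(a\otimes b)(c\otimes d)=(-1)^{|b||c|}ac\otimes bd$, and the antipode is even), and suppose that $A$ is commutative as a superalgebra: $ab=(-1)^{|a||b|}ba$ for all homogeneous $a,b\in A$. Let $B\subseteq A$ be a left coideal supersubalgebra, that is, a unital $\mathbb{Z}_2$-graded subalgebra with $\delta(B)\subseteq A\otimes B$. Then $A$ is a flat left $B$-module: the functor $X\mapsto X\otimes_B A$ from the category of all (not necessarily graded) right $B$-modules to abelian groups is exact. -/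

import Mathlib

open scoped TensorProduct

universe u v w

/-! ### Flat left modules over a possibly noncommutative ring -/

section NoncommutativeFlatness

variable (R : Type*) [Ring R]

/-- The subgroup of `X ⊗_ℤ M` generated by the elements `x r ⊗ m - x ⊗ r m`, for a right `R`-module
`X` (that is, a module over the opposite ring) and a left `R`-module `M`. -/
def balancedRelations (X : Type*) [AddCommGroup X] [Module Rᵐᵒᵖ X]
    (M : Type*) [AddCommGroup M] [Module R M] : AddSubgroup (X ⊗[ℤ] M) :=
  AddSubgroup.closure
    {t | ∃ (x : X) (r : R) (m : M), t = (MulOpposite.op r • x) ⊗ₜ[ℤ] m - x ⊗ₜ[ℤ] (r • m)}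

/-- The tensor product `X ⊗_R M` of a right `R`-module and a left `R`-module, an abelian group. -/
abbrev BalancedTensor (X : Type*) [AddCommGroup X] [Module Rᵐᵒᵖ X]
    (M : Type*) [AddCommGroup M] [Module R M] : Type _ :=
  (X ⊗[ℤ] M) ⧸ balancedRelations R X M

/-- The map `f ⊗_R M : X ⊗_R M → Y ⊗_R M` induced by a map `f : X → Y` of right `R`-modules. -/
def BalancedTensor.map {X Y : Type*} [AddCommGroup X] [Module Rᵐᵒᵖ X]
    [AddCommGroup Y] [Module Rᵐᵒᵖ Y] (M : Type*) [AddCommGroup M] [Module R M]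
    (f : X →ₗ[Rᵐᵒᵖ] Y) : BalancedTensor R X M →+ BalancedTensor R Y M :=
  QuotientAddGroup.map (balancedRelations R X M) (balancedRelations R Y M)
    (LinearMap.rTensor M f.toAddMonoidHom.toIntLinearMap).toAddMonoidHom <| by
      rw [balancedRelations, AddSubgroup.closure_le]
      rintro _ ⟨x, r, m, rfl⟩
      refine AddSubgroup.subset_closure ⟨f x, r, m, ?_⟩
      rw [map_sub]
      exact congrArg (fun y => y ⊗ₜ[ℤ] m - f x ⊗ₜ[ℤ] (r • m)) (f.map_smul (MulOpposite.op r) x)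

/-- A left `R`-module `M` is flat if the functor `X ↦ X ⊗_R M` from right `R`-modules to abelian
groups is exact, i.e. preserves exactness of every sequence `X → Y → Z`. -/
def IsFlatLeftModule (R : Type u) [Ring R] (M : Type v) [AddCommGroup M] [Module R M] :
    Prop :=
  ∀ (X Y Z : Type w) [AddCommGroup X] [AddCommGroup Y] [AddCommGroup Z]
    [Module Rᵐᵒᵖ X] [Module Rᵐᵒᵖ Y] [Module Rᵐᵒᵖ Z]
    (f : X →ₗ[Rᵐᵒᵖ] Y) (g : Y →ₗ[Rᵐᵒᵖ] Z),
    Function.Exact f g →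
      Function.Exact (BalancedTensor.map R M f) (BalancedTensor.map R M g)

end NoncommutativeFlatness

/-! ### Hopf superalgebras and their coideal supersubalgebras

A superalgebra over `K` is an associative unital `K`-algebra `A` with a grading
`𝒜 : ZMod 2 → Submodule K A`. -/

section Super

variable {K : Type*} [Field K] {A : Type*} [Ring A] [Algebra K A]

/-- The superalgebra is commutative: `a b = (-1)^{|a||b|} b a` for homogeneous `a`, `b`. -/
def IsSuperCommutative (𝒜 : ZMod 2 → Submodule K A) : Prop :=
  ∀ (i j : ZMod 2) (a b : A), a ∈ 𝒜 i → b ∈ 𝒜 j → a * b = ((-1 : ℤˣ) ^ (i * j)) • (b * a)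

/-- A Hopf superalgebra: a superalgebra with a supercoalgebra structure such that the
comultiplication `A → A ⊗ A` and the counit `A → K` are morphisms of superalgebras (where `A ⊗ A`
carries the product `(a ⊗ b)(c ⊗ d) = (-1)^{|b||c|} ac ⊗ bd` of the graded tensor product), with an
even antipode. -/
class HopfSuperalgebra (𝒜 : ZMod 2 → Submodule K A) [GradedAlgebra 𝒜] [Coalgebra K A] where
  /-- The comultiplication is even. -/
  comul_mem : ∀ (k : ZMod 2) (a : A), a ∈ 𝒜 k →
    (Coalgebra.comul a : A ⊗[K] A) ∈
      ⨆ i : ZMod 2, LinearMap.range (TensorProduct.map (𝒜 i).subtype (𝒜 (k - i)).subtype)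
  /-- The counit is even, `K` being purely even. -/
  counit_odd : ∀ a : A, a ∈ 𝒜 1 → (Coalgebra.counit a : K) = 0
  comul_one : GradedTensorProduct.of K 𝒜 𝒜 (Coalgebra.comul (1 : A)) = 1
  comul_mul : ∀ a b : A,
    GradedTensorProduct.of K 𝒜 𝒜 (Coalgebra.comul (a * b)) =
      GradedTensorProduct.of K 𝒜 𝒜 (Coalgebra.comul a) *
        GradedTensorProduct.of K 𝒜 𝒜 (Coalgebra.comul b)
  counit_one : (Coalgebra.counit (1 : A) : K) = 1
  counit_mul : ∀ a b : A,
    (Coalgebra.counit (a * b) : K) = Coalgebra.counit a * Coalgebra.counit b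
  /-- The antipode. -/
  antipode : A →ₗ[K] A
  antipode_mem : ∀ (i : ZMod 2) (a : A), a ∈ 𝒜 i → antipode a ∈ 𝒜 i
  mul_antipode_rTensor_comul : ∀ a : A,
    LinearMap.mul' K A (antipode.rTensor A (Coalgebra.comul a)) =
      algebraMap K A (Coalgebra.counit a)
  mul_antipode_lTensor_comul : ∀ a : A,
    LinearMap.mul' K A (antipode.lTensor A (Coalgebra.comul a)) =
      algebraMap K A (Coalgebra.counit a)

/-- `B` is a left coideal supersubalgebra of `A`: a subalgebra that contains the homogeneous
components of its elements, and such that `δ(B) ⊆ A ⊗ B`, i.e. `B` is a left `A`-supercomodule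
through the comultiplication `δ` of `A`. -/
structure IsLeftCoidealSupersubalgebra (𝒜 : ZMod 2 → Submodule K A) [GradedAlgebra 𝒜]
    [Coalgebra K A] (B : Subalgebra K A) : Prop where
  component_mem : ∀ b ∈ B, ∀ i : ZMod 2, (DirectSum.decompose 𝒜 b i : A) ∈ B
  comul_mem : ∀ b ∈ B, (Coalgebra.comul b : A ⊗[K] A) ∈
    LinearMap.range (LinearMap.lTensor A (Subalgebra.toSubmodule B).subtype)

end Super

/-! Flatness is reduced to a statement about fibres at the counit. For a right `B`-module `X`, let
`B` act on `A ⊗ X` by `(a ⊗ x) b = ∑ b₁ σ^{|b|}(a) ⊗ x b₂`, where `σ` is the parity involution and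
`∑ b₁ ⊗ b₂` is the comultiplication with the sign `(-1)^{|b₁||b₂|}` inserted. With this choice no
sign depends on `x`, so `X` need not be graded. The map `x ⊗ a ↦ S(a) ⊗ x` identifies `X ⊗_B A` with
the fibre `(A ⊗ X) / (A ⊗ X) B⁺`, where `B⁺` is the kernel of the counit on `B`.

Since `X ↦ A ⊗ X` is exact over a field, exactness of the fibre functor suffices, and `A ⊗ X` is
moreover a Hopf module: it carries a compatible coaction of `A`. The key is
`IsHopfModule.mem_augmentationSpan_ker`: for a morphism `π : E → F` of Hopf modules, `E B⁺ ∩ ker π =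
(ker π) B⁺`. It holds because `F` behaves near the counit like a free module. Take a
finite-dimensional subcomodule `W` of `F` and lift a basis of `W / (W ∩ W B⁺)` to `u₁, …, uₙ` in
`W`. By Nakayama (`exists_local_generators`) some even `s` in `B` with `ε(s) = 1` satisfies `W s ⊆ ∑
uᵢ B`. By `exists_pow_mul_eq_zero`, a power of `s` kills the coefficients of every relation among
the `uᵢ`: the matrix of coefficients of the `uᵢ` in `A` is right invertible up to `s` thanks to the
antipode, hence left invertible up to a power of `s`.

Both matrix arguments use determinants over the even part, which is central, and treat the odd part
as a nilpotent perturbation. -/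

section MatrixLemmas

/-! ### Matrices over algebras with a central even part and anticommuting odd part -/

/-- A `K`-algebra `R` is split by a central commutative ring `Z` (through `f`) and a space `O` of
pairwise anticommuting elements of square zero. -/
structure IsSuperSplit {K Z R : Type*} [Field K] [CommRing Z] [Ring R] [Algebra K R]
    (f : Z →+* R) (O : Submodule K R) : Prop where
  injective : Function.Injective f
  central : ∀ z r, Commute (f z) r
  anti : ∀ x ∈ O, ∀ y ∈ O, x * y = -(y * x)
  sq_zero : ∀ x ∈ O, x * x = 0
  even_mul_odd : ∀ z, ∀ x ∈ O, f z * x ∈ O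
  decomp : ∀ r, ∃ z, ∃ x ∈ O, r = f z + x
  disjoint : ∀ z, f z ∈ O → f z = 0

namespace IsSuperSplit

variable {K Z R : Type*} [Field K] [CommRing Z] [Ring R] [Algebra K R]
  {f : Z →+* R} {O : Submodule K R}

/-- Moving an odd `x` past `z + t` only changes the sign of the odd part `t`, so left and right
multiples of `x` agree and `x R` is a two-sided ideal. -/
theorem top_mul_span (h : IsSuperSplit f O) {x : R} (hx : x ∈ O) :
    (⊤ : Submodule K R) * Submodule.span K {x} = Submodule.span K {x} * ⊤ := by
  apply le_antisymm
  · rw [Submodule.mul_le]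
    intro a _ y hy
    obtain ⟨c, rfl⟩ := Submodule.mem_span_singleton.1 hy
    obtain ⟨z, t, ht, rfl⟩ := h.decomp a
    have : (f z + t) * c • x = x * (c • (f z - t)) := by
      rw [mul_smul_comm, mul_smul_comm, add_mul, mul_sub, (h.central z x).eq, h.anti t ht x hx,
        sub_eq_add_neg]
    rw [this]
    exact Submodule.mul_mem_mul (Submodule.mem_span_singleton_self x) trivial
  · rw [Submodule.mul_le]
    intro y hy a _
    obtain ⟨c, rfl⟩ := Submodule.mem_span_singleton.1 hy
    obtain ⟨z, t, ht, rfl⟩ := h.decomp a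
    have : c • x * (f z + t) = (c • (f z - t)) * x := by
      rw [smul_mul_assoc, smul_mul_assoc, mul_add, sub_mul, (h.central z x).eq, h.anti x hx t ht,
        sub_eq_add_neg]
    rw [this]
    exact Submodule.mul_mem_mul trivial (Submodule.mem_span_singleton_self x)

theorem isNilpotent_span_mul_top (h : IsSuperSplit f O) {x : R} (hx : x ∈ O) :
    IsNilpotent (Submodule.span K {x} * (⊤ : Submodule K R)) := by
  refine ⟨2, ?_⟩
  rw [pow_two, mul_assoc, ← mul_assoc ⊤, h.top_mul_span hx, ← mul_assoc, ← mul_assoc,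
    Submodule.span_mul_span, Set.singleton_mul_singleton, h.sq_zero x hx,
    Submodule.span_zero_singleton]
  simp

theorem commute_span_mul_top (h : IsSuperSplit f O) {x y : R} (hx : x ∈ O) (hy : y ∈ O) :
    Commute (Submodule.span K {x} * (⊤ : Submodule K R)) (Submodule.span K {y} * ⊤) := by
  have hc : Submodule.span K {x} * Submodule.span K {y} =
      Submodule.span K {y} * Submodule.span K {x} := by
    rw [Submodule.span_mul_span, Submodule.span_mul_span, Set.singleton_mul_singleton,
      Set.singleton_mul_singleton, h.anti x hx y hy, ← Set.neg_singleton, Submodule.span_neg]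
  calc _ = Submodule.span K {x} * (⊤ * Submodule.span K {y}) * ⊤ := by simp only [mul_assoc]
    _ = Submodule.span K {x} * Submodule.span K {y} * (⊤ * ⊤) := by
      rw [h.top_mul_span hy]; simp only [mul_assoc]
    _ = Submodule.span K {y} * (Submodule.span K {x} * ⊤) * ⊤ := by
      rw [hc]; simp only [mul_assoc]
    _ = _ := by
      rw [mul_assoc (Submodule.span K {y}) ⊤, ← mul_assoc ⊤, h.top_mul_span hx, mul_assoc]

/-- Each odd entry generates an ideal of square zero and these ideals commute. Their sum `J` over
the finitely many entries of `P` is therefore nilpotent, and the entries of `(P * Q) ^ l` lie in `J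
^ l`. -/
theorem isNilpotent_mul (h : IsSuperSplit f O) {m n : Type*} [Fintype m] [Fintype n]
    [DecidableEq m] (P : Matrix m n R) (Q : Matrix n m R) (hP : ∀ i j, P i j ∈ O) :
    IsNilpotent (P * Q) := by
  obtain ⟨k, hk⟩ : IsNilpotent (∑ p : m × n, Submodule.span K {P p.1 p.2} * (⊤ : Submodule K R)) :=
    Commute.isNilpotent_sum (fun p _ => h.isNilpotent_span_mul_top (hP _ _))
      (fun p q _ _ => h.commute_span_mul_top (hP _ _) (hP _ _))
  set J := ∑ p : m × n, Submodule.span K {P p.1 p.2} * (⊤ : Submodule K R) with hJ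
  have hmem : ∀ i j, (P * Q) i j ∈ J := by
    intro i j
    rw [Matrix.mul_apply]
    refine Submodule.sum_mem _ fun l _ => ?_
    have : Submodule.span K {P i l} * (⊤ : Submodule K R) ≤ J := by
      classical
      rw [hJ, ← Finset.add_sum_erase _ _ (Finset.mem_univ (i, l)), Submodule.add_eq_sup]
      exact le_sup_left
    exact this (Submodule.mul_mem_mul (Submodule.mem_span_singleton_self _) trivial)
  have hpow : ∀ (l : ℕ) (i j : m), ((P * Q) ^ l) i j ∈ J ^ l := by
    intro l
    induction l with
    | zero =>
      intro i j
      rw [pow_zero, pow_zero, Matrix.one_apply]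
      split_ifs
      · exact Submodule.one_le.1 le_rfl
      · exact Submodule.zero_mem _
    | succ l ih =>
      intro i j
      rw [pow_succ, pow_succ, Matrix.mul_apply]
      exact Submodule.sum_mem _ fun t _ => Submodule.mul_mem_mul (ih i t) (hmem t j)
  refine ⟨k, ?_⟩
  ext i j
  have := hpow k i j
  rw [hk] at this
  simpa using this

/-- The truncated geometric series gives `s ^ k - D ^ k`, and `D ^ k = 0`. -/
theorem exists_mul_eq_scalar_pow {R n : Type*} [Ring R] [Fintype n] [DecidableEq n] {s : R}
    (hs : ∀ r, Commute s r) {D : Matrix n n R} (hD : IsNilpotent D) :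
    ∃ (k : ℕ) (X : Matrix n n R), (Matrix.scalar n s - D) * X = Matrix.scalar n (s ^ k) ∧
      X * (Matrix.scalar n s - D) = Matrix.scalar n (s ^ k) := by
  obtain ⟨k, hk⟩ := hD
  have hc : Commute (Matrix.scalar n s) D := Matrix.scalar_commute s hs D
  refine ⟨k, ∑ i ∈ Finset.range k, Matrix.scalar n s ^ i * D ^ (k - 1 - i), ?_, ?_⟩
  · rw [hc.mul_geom_sum₂, hk, sub_zero, map_pow]
  · rw [hc.geom_sum₂_mul, hk, sub_zero, map_pow]

variable {n : Type*} [Fintype n] [DecidableEq n]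

theorem exists_split_matrix (h : IsSuperSplit f O) (P : Matrix n n R) :
    ∃ (P₀ : Matrix n n Z) (P₁ : Matrix n n R), P = f.mapMatrix P₀ + P₁ ∧ ∀ i j, P₁ i j ∈ O := by
  choose z x hx hzx using fun i j => h.decomp (P i j)
  exact ⟨Matrix.of z, Matrix.of x, by ext i j; simpa using hzx i j, hx⟩

theorem mapMatrix_smul_one (f : Z →+* R) (z : Z) :
    f.mapMatrix (z • (1 : Matrix n n Z)) = Matrix.scalar n (f z) := by
  ext i j
  by_cases hij : i = j <;> simp [hij]

theorem mapMatrix_mul_odd (h : IsSuperSplit f O) (P : Matrix n n Z) (Q : Matrix n n R)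
    (hQ : ∀ i j, Q i j ∈ O) (i j : n) : (f.mapMatrix P * Q) i j ∈ O := by
  rw [Matrix.mul_apply]
  exact Submodule.sum_mem _ fun l _ => by simpa using h.even_mul_odd _ _ (hQ l j)

/-- If the entries of `C` are killed by a character, then `1 - C` is right invertible up to an even
scalar of character value one. -/
theorem exists_one_sub_mul_eq_scalar (h : IsSuperSplit f O) (ε : R →ₐ[K] K)
    (hε : ∀ x ∈ O, ε x = 0) (C : Matrix n n R) (hC : ∀ i j, ε (C i j) = 0) :
    ∃ (Q : Matrix n n R) (s : Z), ε (f s) = 1 ∧ (1 - C) * Q = Matrix.scalar n (f s) := by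
  obtain ⟨C₀, C₁, rfl, hC₁⟩ := h.exists_split_matrix C
  have hC₀ : ∀ i j, ε (f (C₀ i j)) = 0 := by
    intro i j
    have := hC i j
    simpa [hε _ (hC₁ i j)] using this
  -- The adjugate inverts the even part of `1 - C` up to `d`. The character turns `1 - C₀` into the
  -- identity matrix, so `d` has value one.
  set d := (1 - C₀).det
  have hd : ε (f d) = 1 := by
    have : ((ε : R →+* K).comp f) d = 1 := by
      rw [RingHom.map_det]
      convert Matrix.det_one (n := n) (R := K)
      ext i j
      by_cases hij : i = j <;> simp [hij, hC₀, Matrix.one_apply]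
    exact this
  have hmul : (1 - (f.mapMatrix C₀ + C₁)) * f.mapMatrix (1 - C₀).adjugate =
      Matrix.scalar n (f d) - C₁ * f.mapMatrix (1 - C₀).adjugate := by
    rw [← mapMatrix_smul_one, ← Matrix.mul_adjugate, map_mul, map_sub, map_one, ← sub_sub, sub_mul]
  obtain ⟨k, X, hX, -⟩ := exists_mul_eq_scalar_pow (h.central d)
    (h.isNilpotent_mul C₁ (f.mapMatrix (1 - C₀).adjugate) hC₁)
  refine ⟨f.mapMatrix (1 - C₀).adjugate * X, d ^ k, by simp [hd], ?_⟩
  rw [← mul_assoc, hmul, hX, map_pow f]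

/-- A matrix that is right invertible up to an even scalar is left invertible up to a power of this
scalar. -/
theorem exists_mul_eq_scalar_of_mul_eq_scalar (h : IsSuperSplit f O) (P Q : Matrix n n R) (s : Z)
    (hPQ : P * Q = Matrix.scalar n (f s)) :
    ∃ (X : Matrix n n R) (k : ℕ), X * P = Matrix.scalar n (f s ^ k) := by
  obtain ⟨P₀, P₁, rfl, hP₁⟩ := h.exists_split_matrix P
  obtain ⟨N, Y, hY, -⟩ := exists_mul_eq_scalar_pow (h.central s) (h.isNilpotent_mul P₁ Q hP₁)
  -- Since `P₀ Q = s - P₁ Q` with `P₁ Q` nilpotent, the even part `P₀` is itself right invertible up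
  -- to a power of `s`.
  have h1 : f.mapMatrix P₀ * (Q * Y) = Matrix.scalar n (f s ^ N) := by
    rw [← mul_assoc, ← hY, ← hPQ, add_mul, add_sub_cancel_right]
  obtain ⟨Y₀, Y₁, hYs, hY₁⟩ := h.exists_split_matrix (Q * Y)
  rw [hYs, mul_add] at h1
  -- Comparing even parts discards `Y₁`. The equation now lives over the commutative ring `Z`, where
  -- determinants turn a right inverse into a left one.
  have h2 : P₀ * Y₀ = s ^ N • (1 : Matrix n n Z) := by
    have h3 : f.mapMatrix (P₀ * Y₀ - s ^ N • (1 : Matrix n n Z)) = - (f.mapMatrix P₀ * Y₁) := by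
      rw [map_sub, mapMatrix_smul_one, map_pow, ← h1, map_mul, sub_add_cancel_left]
    rw [← sub_eq_zero]
    ext i j
    refine (map_eq_zero_iff f h.injective).1 (h.disjoint _ ?_)
    change f.mapMatrix (P₀ * Y₀ - s ^ N • (1 : Matrix n n Z)) i j ∈ O
    rw [h3]
    exact O.neg_mem (h.mapMatrix_mul_odd _ _ hY₁ i j)
  have h4 : Y₀.det * P₀.det = s ^ (N * Fintype.card n) := by
    rw [mul_comm, ← Matrix.det_mul, h2, Matrix.det_smul, Matrix.det_one, mul_one, pow_mul]
  set L := Y₀.det • P₀.adjugate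
  have hL : L * P₀ = s ^ (N * Fintype.card n) • (1 : Matrix n n Z) := by
    rw [Matrix.smul_mul, Matrix.adjugate_mul, smul_smul, h4]
  set M := N * Fintype.card n
  have h5 : f.mapMatrix L * (f.mapMatrix P₀ + P₁) =
      Matrix.scalar n (f (s ^ M)) - (-(f.mapMatrix L * P₁)) * 1 := by
    rw [mul_add, ← map_mul, hL, mapMatrix_smul_one, mul_one, sub_neg_eq_add]
  -- The left inverse `L` of the even part is corrected by a geometric series; the factor `1` only
  -- puts the odd matrix into the product form required by `isNilpotent_mul`.
  obtain ⟨k, X, -, hX⟩ := exists_mul_eq_scalar_pow (h.central (s ^ M))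
    (h.isNilpotent_mul (-(f.mapMatrix L * P₁)) 1
      fun i j => O.neg_mem (h.mapMatrix_mul_odd _ _ hP₁ i j))
  exact ⟨X * f.mapMatrix L, M * k, by rw [mul_assoc, h5, hX, map_pow f, ← pow_mul]⟩

end IsSuperSplit
end MatrixLemmas

/-! ### Parity involution and Koszul signs -/

section Parity

variable {K : Type*} [Field K] {A : Type*} [Ring A] [Algebra K A]
  (𝒜 : ZMod 2 → Submodule K A) [GradedAlgebra 𝒜]

/-- The projection of a superalgebra onto its component of degree `i`. -/
noncomputable def superProj (i : ZMod 2) : A →ₗ[K] A := GradedAlgebra.proj 𝒜 i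

/-- The parity involution of a superalgebra. -/
noncomputable def parity : A →ₗ[K] A := superProj 𝒜 0 - superProj 𝒜 1

/-- The power of the parity involution given by a degree. -/
noncomputable def twist (j : ZMod 2) : A →ₗ[K] A := if j = 0 then LinearMap.id else parity 𝒜

@[simp] theorem twist_zero : twist 𝒜 0 = LinearMap.id := if_pos rfl

@[simp] theorem twist_one : twist 𝒜 1 = parity 𝒜 := if_neg one_ne_zero

/-- The operator `x ⊗ y ↦ (-1)^{|x||y|} x ⊗ y`. -/
noncomputable def koszulSign : A ⊗[K] A →ₗ[K] A ⊗[K] A :=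
  TensorProduct.map LinearMap.id (superProj 𝒜 0) +
    TensorProduct.map (parity 𝒜) (superProj 𝒜 1)

variable {𝒜}

@[simp] theorem proj_zero_of_even {x : A} (hx : x ∈ 𝒜 0) : superProj 𝒜 0 x = x :=
  DirectSum.decompose_of_mem_same _ hx

@[simp] theorem proj_one_of_even {x : A} (hx : x ∈ 𝒜 0) : superProj 𝒜 1 x = 0 :=
  DirectSum.decompose_of_mem_ne _ hx zero_ne_one

@[simp] theorem proj_one_of_odd {x : A} (hx : x ∈ 𝒜 1) : superProj 𝒜 1 x = x :=
  DirectSum.decompose_of_mem_same _ hx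

@[simp] theorem proj_zero_of_odd {x : A} (hx : x ∈ 𝒜 1) : superProj 𝒜 0 x = 0 :=
  DirectSum.decompose_of_mem_ne _ hx one_ne_zero

@[simp] theorem parity_of_even {x : A} (hx : x ∈ 𝒜 0) : parity 𝒜 x = x := by
  simp [parity, hx]

@[simp] theorem parity_of_odd {x : A} (hx : x ∈ 𝒜 1) : parity 𝒜 x = -x := by
  simp [parity, hx]

theorem proj_zero_add_proj_one (x : A) :
    superProj 𝒜 0 x + superProj 𝒜 1 x = x := by
  classical
  conv_rhs => rw [← DirectSum.sum_support_decompose 𝒜 x]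
  rw [Finset.sum_subset (Finset.subset_univ _)]
  · exact (Fin.sum_univ_two (fun i : ZMod 2 => (DirectSum.decompose 𝒜 x i : A))).symm
  · intro i _ hi
    simpa using hi

theorem proj_mem (i : ZMod 2) (x : A) : superProj 𝒜 i x ∈ 𝒜 i :=
  SetLike.coe_mem _

theorem super_induction {P : A → Prop} (x : A) (heven : ∀ x ∈ 𝒜 0, P x) (hodd : ∀ x ∈ 𝒜 1, P x)
    (hadd : ∀ x y, P x → P y → P (x + y)) : P x := by
  rw [← proj_zero_add_proj_one (𝒜 := 𝒜) x]
  exact hadd _ _ (heven _ (proj_mem 0 x)) (hodd _ (proj_mem 1 x))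

theorem super_cases (i : ZMod 2) : i = 0 ∨ i = 1 := by
  revert i; decide

theorem even_mul_even {x y : A} (hx : x ∈ 𝒜 0) (hy : y ∈ 𝒜 0) : x * y ∈ 𝒜 0 :=
  SetLike.mul_mem_graded (A := 𝒜) (i := 0) (j := 0) hx hy

theorem even_mul_odd {x y : A} (hx : x ∈ 𝒜 0) (hy : y ∈ 𝒜 1) : x * y ∈ 𝒜 1 :=
  SetLike.mul_mem_graded (A := 𝒜) (i := 0) (j := 1) hx hy

theorem odd_mul_even {x y : A} (hx : x ∈ 𝒜 1) (hy : y ∈ 𝒜 0) : x * y ∈ 𝒜 1 :=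
  SetLike.mul_mem_graded (A := 𝒜) (i := 1) (j := 0) hx hy

theorem odd_mul_odd {x y : A} (hx : x ∈ 𝒜 1) (hy : y ∈ 𝒜 1) : x * y ∈ 𝒜 0 :=
  SetLike.mul_mem_graded (A := 𝒜) (i := 1) (j := 1) hx hy

theorem parity_mem {i : ZMod 2} {x : A} (hx : x ∈ 𝒜 i) : parity 𝒜 x ∈ 𝒜 i := by
  obtain rfl | rfl := super_cases i <;> simp [hx]

@[simp] theorem parity_parity (x : A) : parity 𝒜 (parity 𝒜 x) = x := by
  induction x using super_induction (𝒜 := 𝒜) with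
  | heven x hx => simp [hx]
  | hodd x hx => simp [hx]
  | hadd x y hx hy => simp [hx, hy]

theorem IsSuperCommutative.even_mul (h : IsSuperCommutative 𝒜) {x : A} (hx : x ∈ 𝒜 0) (y : A) :
    x * y = y * x := by
  induction y using super_induction (𝒜 := 𝒜) with
  | heven y hy => simpa using h 0 0 x y hx hy
  | hodd y hy => simpa using h 0 1 x y hx hy
  | hadd y z hy hz => rw [mul_add, add_mul, hy, hz]

omit [GradedAlgebra 𝒜] in
theorem IsSuperCommutative.odd_mul_odd (h : IsSuperCommutative 𝒜) {x y : A} (hx : x ∈ 𝒜 1)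
    (hy : y ∈ 𝒜 1) : x * y = -(y * x) := by
  simpa using h 1 1 x y hx hy

theorem IsSuperCommutative.mul_eq (h : IsSuperCommutative 𝒜) {j : ZMod 2} (x : A) {y : A}
    (hy : y ∈ 𝒜 j) : x * y = y * twist 𝒜 j x := by
  obtain rfl | rfl := super_cases j
  · simpa using (h.even_mul hy x).symm
  · induction x using super_induction (𝒜 := 𝒜) with
    | heven x hx => simp [hx, h.even_mul hx]
    | hodd x hx => simp [hx, h.odd_mul_odd hx hy]
    | hadd x z hx hz => simp only [map_add, add_mul, mul_add, hx, hz]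

theorem koszulSign_tmul_even (x : A) {y : A} (hy : y ∈ 𝒜 0) : koszulSign 𝒜 (x ⊗ₜ y) = x ⊗ₜ y := by
  simp [koszulSign, hy]

theorem koszulSign_tmul_odd (x : A) {y : A} (hy : y ∈ 𝒜 1) :
    koszulSign 𝒜 (x ⊗ₜ y) = parity 𝒜 x ⊗ₜ y := by
  simp [koszulSign, hy]

theorem koszulSign_tmul {i : ZMod 2} (x : A) {y : A} (hy : y ∈ 𝒜 i) :
    koszulSign 𝒜 (x ⊗ₜ y) = twist 𝒜 i x ⊗ₜ y := by
  obtain rfl | rfl := super_cases i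
  · simp [koszulSign_tmul_even _ hy]
  · simp [koszulSign_tmul_odd _ hy]

variable (𝒜) in
/-- The homogeneous component of degree `k` of `A ⊗ A`. -/
noncomputable def tensorDegree (k : ZMod 2) : Submodule K (A ⊗[K] A) :=
  ⨆ i : ZMod 2, LinearMap.range (TensorProduct.map (𝒜 i).subtype (𝒜 (k - i)).subtype)

omit [GradedAlgebra 𝒜] in
theorem tensorDegree_induction {k : ZMod 2} {P : A ⊗[K] A → Prop} {t : A ⊗[K] A}
    (ht : t ∈ tensorDegree 𝒜 k)
    (htmul : ∀ i, ∀ x ∈ 𝒜 i, ∀ y ∈ 𝒜 (k - i), P (x ⊗ₜ y))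
    (hadd : ∀ s t, P s → P t → P (s + t)) : P t := by
  have h0 : P 0 := by simpa using htmul 0 0 (zero_mem _) 0 (zero_mem _)
  refine Submodule.iSup_induction _ (motive := P) ht ?_ h0 hadd
  rintro i _ ⟨s, rfl⟩
  induction s with
  | zero => simpa using h0
  | tmul x y => simpa using htmul i x x.2 y y.2
  | add s t hs ht => simpa using hadd _ _ hs ht

theorem parity_mul (x y : A) : parity 𝒜 (x * y) = parity 𝒜 x * parity 𝒜 y := by
  induction x using super_induction (𝒜 := 𝒜) with
  | hadd x z hx hz => simp only [map_add, add_mul, hx, hz]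
  | heven x hx =>
    induction y using super_induction (𝒜 := 𝒜) with
    | hadd y z hy hz => simp only [map_add, mul_add, hy, hz]
    | heven y hy => simp [hx, hy, even_mul_even hx hy]
    | hodd y hy => simp [hx, hy, even_mul_odd hx hy]
  | hodd x hx =>
    induction y using super_induction (𝒜 := 𝒜) with
    | hadd y z hy hz => simp only [map_add, mul_add, hy, hz]
    | heven y hy => simp [hx, hy, odd_mul_even hx hy]
    | hodd y hy => simp [hx, hy, odd_mul_odd hx hy]

variable (𝒜) in
/-- The operation `(x ⊗ y, x' ⊗ y') ↦ x' σ^j(x) ⊗ y y'`. -/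
noncomputable def twistedMul (j : ZMod 2) : A ⊗[K] A →ₗ[K] A ⊗[K] A →ₗ[K] A ⊗[K] A :=
  TensorProduct.map₂ ((LinearMap.mul K A).flip ∘ₗ twist 𝒜 j) (LinearMap.mul K A)

@[simp] theorem twistedMul_tmul (j : ZMod 2) (x y x' y' : A) :
    twistedMul 𝒜 j (x ⊗ₜ y) (x' ⊗ₜ y') = (x' * twist 𝒜 j x) ⊗ₜ (y * y') := by
  simp [twistedMul]

theorem graded_tmul_mul_tmul {i j : ZMod 2} (x : A) {y x' : A} (y' : A)
    (hy : y ∈ 𝒜 i) (hx' : x' ∈ 𝒜 j) :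
    GradedTensorProduct.of K 𝒜 𝒜 (x ⊗ₜ y) * GradedTensorProduct.of K 𝒜 𝒜 (x' ⊗ₜ y') =
      GradedTensorProduct.of K 𝒜 𝒜 ((x * twist 𝒜 i x') ⊗ₜ (y * y')) := by
  have := GradedTensorProduct.tmul_coe_mul_coe_tmul (R := K) 𝒜 𝒜 x ⟨y, hy⟩ ⟨x', hx'⟩ y'
  refine this.trans ?_
  obtain rfl | rfl := super_cases i
  · simp
  · obtain rfl | rfl := super_cases j
    · simp [hx']
    · simp [hx', TensorProduct.neg_tmul]

/-- After cancelling the signs internal to each factor, `(x ⊗ y)(x' ⊗ y')` carries `(-1)^{|x||y'|}`,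
and reordering `x x'` adds `(-1)^{|x||x'|}`. The total `(-1)^{|x| j}` depends on the second factor
only through its degree `j`, and not at all on `y`. -/
theorem koszulSign_mul (h : IsSuperCommutative 𝒜) {j : ZMod 2} (s : A ⊗[K] A) {t : A ⊗[K] A}
    (ht : t ∈ tensorDegree 𝒜 j) :
    koszulSign 𝒜 ((GradedTensorProduct.of K 𝒜 𝒜).symm
      (GradedTensorProduct.of K 𝒜 𝒜 s * GradedTensorProduct.of K 𝒜 𝒜 t)) =
      twistedMul 𝒜 j (koszulSign 𝒜 s) (koszulSign 𝒜 t) := by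
  refine tensorDegree_induction (P := fun t => koszulSign 𝒜 ((GradedTensorProduct.of K 𝒜 𝒜).symm
      (GradedTensorProduct.of K 𝒜 𝒜 s * GradedTensorProduct.of K 𝒜 𝒜 t)) =
      twistedMul 𝒜 j (koszulSign 𝒜 s) (koszulSign 𝒜 t)) ht (fun k x' hx' y' hy' => ?_)
    fun s t hs ht => by simp only [map_add, mul_add, hs, ht]
  have key : ∀ i, ∀ y ∈ 𝒜 i, ∀ x, koszulSign 𝒜 ((GradedTensorProduct.of K 𝒜 𝒜).symm
      (GradedTensorProduct.of K 𝒜 𝒜 (x ⊗ₜ y) * GradedTensorProduct.of K 𝒜 𝒜 (x' ⊗ₜ y'))) =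
      twistedMul 𝒜 j (koszulSign 𝒜 (x ⊗ₜ y)) (koszulSign 𝒜 (x' ⊗ₜ y')) := by
    intro i y hy x
    have hyy : y * y' ∈ 𝒜 (i + (j - k)) := SetLike.mul_mem_graded (A := 𝒜) hy hy'
    rw [graded_tmul_mul_tmul x y' hy hx', GradedTensorProduct.of_symm_of,
      koszulSign_tmul x hy, koszulSign_tmul x' hy', koszulSign_tmul _ hyy, twistedMul_tmul]
    congr 1
    clear hyy hy ht
    have h1 : (-1 : ZMod 2) = 1 := rfl
    have h3 : (1 + 1 : ZMod 2) = 0 := rfl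
    obtain rfl | rfl := super_cases i <;> obtain rfl | rfl := super_cases j <;>
      obtain rfl | rfl := super_cases k <;>
      simp [hx', h1, h3, h.mul_eq x hx', parity_mul]
  induction s with
  | zero => simp
  | add s t hs ht => simp only [map_add, add_mul, LinearMap.add_apply, hs, ht]
  | tmul x y =>
    induction y using super_induction (𝒜 := 𝒜) with
    | hadd y z hy hz =>
      simp only [TensorProduct.tmul_add, map_add, add_mul, LinearMap.add_apply, hy, hz]
    | heven y hy => exact key 0 y hy x
    | hodd y hy => exact key 1 y hy x

end Parity

/-! ### The comultiplication with Koszul sign -/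

section SuperComul

variable {K : Type*} [Field K] {A : Type*} [Ring A] [Algebra K A]
  {𝒜 : ZMod 2 → Submodule K A} [GradedAlgebra 𝒜]

theorem tensor_induction {P : A ⊗[K] A → Prop} (t : A ⊗[K] A)
    (htmul : ∀ i j, ∀ x ∈ 𝒜 i, ∀ y ∈ 𝒜 j, P (x ⊗ₜ y))
    (hadd : ∀ s t, P s → P t → P (s + t)) : P t := by
  induction t with
  | zero => simpa using htmul 0 0 0 (zero_mem _) 0 (zero_mem _)
  | add s t hs ht => exact hadd s t hs ht
  | tmul x y =>
    induction x using super_induction (𝒜 := 𝒜) with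
    | hadd x z hx hz => rw [TensorProduct.add_tmul]; exact hadd _ _ hx hz
    | heven x hx =>
      induction y using super_induction (𝒜 := 𝒜) with
      | hadd y z hy hz => rw [TensorProduct.tmul_add]; exact hadd _ _ hy hz
      | heven y hy => exact htmul 0 0 x hx y hy
      | hodd y hy => exact htmul 0 1 x hx y hy
    | hodd x hx =>
      induction y using super_induction (𝒜 := 𝒜) with
      | hadd y z hy hz => rw [TensorProduct.tmul_add]; exact hadd _ _ hy hz
      | heven y hy => exact htmul 1 0 x hx y hy
      | hodd y hy => exact htmul 1 1 x hx y hy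

theorem twist_mem {i : ZMod 2} (j : ZMod 2) {x : A} (hx : x ∈ 𝒜 i) : twist 𝒜 j x ∈ 𝒜 i := by
  obtain rfl | rfl := super_cases j
  · simpa using hx
  · simpa using parity_mem hx

omit [GradedAlgebra 𝒜] in
theorem tmul_mem_tensorDegree {i k : ZMod 2} {x y : A} (hx : x ∈ 𝒜 i) (hy : y ∈ 𝒜 (k - i)) :
    x ⊗ₜ y ∈ tensorDegree 𝒜 k :=
  Submodule.mem_iSup_of_mem i ⟨(⟨x, hx⟩ : 𝒜 i) ⊗ₜ (⟨y, hy⟩ : 𝒜 (k - i)), by simp⟩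

theorem koszulSign_mem {k : ZMod 2} {t : A ⊗[K] A} (ht : t ∈ tensorDegree 𝒜 k) :
    koszulSign 𝒜 t ∈ tensorDegree 𝒜 k := by
  refine tensorDegree_induction (P := fun t => koszulSign 𝒜 t ∈ tensorDegree 𝒜 k) ht ?_ ?_
  · intro i x hx y hy
    rw [koszulSign_tmul x hy]
    exact tmul_mem_tensorDegree (twist_mem _ hx) hy
  · intro s t hs ht
    rw [map_add]
    exact add_mem hs ht

theorem superProj_of_mem {i j : ZMod 2} {x : A} (hx : x ∈ 𝒜 i) :
    superProj 𝒜 j x = if i = j then x else 0 := by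
  split_ifs with h
  · subst h
    exact DirectSum.decompose_of_mem_same _ hx
  · exact DirectSum.decompose_of_mem_ne _ hx h

theorem tensorDegree_parity {k : ZMod 2} {t : A ⊗[K] A} (ht : t ∈ tensorDegree 𝒜 k) :
    TensorProduct.map (twist 𝒜 1) (twist 𝒜 1) t = (-1 : K) ^ k.val • t := by
  refine tensorDegree_induction
    (P := fun t => TensorProduct.map (twist 𝒜 1) (twist 𝒜 1) t = (-1 : K) ^ k.val • t) ht ?_ ?_
  · intro i x hx y hy
    have h1 : (-1 : ZMod 2) = 1 := rfl
    have h2 : ZMod.val (1 : ZMod 2) = 1 := rfl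
    obtain rfl | rfl := super_cases i <;> obtain rfl | rfl := super_cases k <;>
      simp_all [TensorProduct.neg_tmul, TensorProduct.tmul_neg]
  · intro s t hs ht
    rw [map_add, hs, ht, smul_add]

variable (𝒜) in
/-- The operator `x ⊗ y ⊗ z ↦ (-1)^{|x||y|+|x||z|+|y||z|} x ⊗ y ⊗ z`. -/
noncomputable def koszulSignThree : A ⊗[K] (A ⊗[K] A) →ₗ[K] A ⊗[K] (A ⊗[K] A) :=
  (koszulSign 𝒜).lTensor A ∘ₗ
    (TensorProduct.map LinearMap.id (TensorProduct.map (superProj 𝒜 0) (superProj 𝒜 0)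
      + TensorProduct.map (superProj 𝒜 1) (superProj 𝒜 1)) +
    TensorProduct.map (parity 𝒜) (TensorProduct.map (superProj 𝒜 0) (superProj 𝒜 1)
      + TensorProduct.map (superProj 𝒜 1) (superProj 𝒜 0)))

theorem koszulSignThree_tmul {i j : ZMod 2} (x : A) {y z : A} (hy : y ∈ 𝒜 i) (hz : z ∈ 𝒜 j) :
    koszulSignThree 𝒜 (x ⊗ₜ (y ⊗ₜ z)) = twist 𝒜 (i + j) x ⊗ₜ (twist 𝒜 j y ⊗ₜ z) := by
  have h3 : (1 + 1 : ZMod 2) = 0 := rfl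
  obtain rfl | rfl := super_cases i <;> obtain rfl | rfl := super_cases j <;>
    simp [koszulSignThree, hy, hz, koszulSign_tmul_even, koszulSign_tmul_odd, h3]

theorem twist_twist (i j : ZMod 2) (x : A) : twist 𝒜 i (twist 𝒜 j x) = twist 𝒜 (i + j) x := by
  have h3 : (1 + 1 : ZMod 2) = 0 := rfl
  obtain rfl | rfl := super_cases i <;> obtain rfl | rfl := super_cases j <;> simp [h3]

variable [Coalgebra K A]

variable (𝒜) in
/-- The comultiplication `a ↦ (-1)^{|a₁||a₂|} a₁ ⊗ a₂`. -/
noncomputable def superComul : A →ₗ[K] A ⊗[K] A := koszulSign 𝒜 ∘ₗ Coalgebra.comul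

variable [HopfSuperalgebra 𝒜]

theorem comul_mem {k : ZMod 2} {a : A} (ha : a ∈ 𝒜 k) :
    (Coalgebra.comul a : A ⊗[K] A) ∈ tensorDegree 𝒜 k :=
  HopfSuperalgebra.comul_mem k a ha

theorem superComul_mem {k : ZMod 2} {a : A} (ha : a ∈ 𝒜 k) :
    superComul 𝒜 a ∈ tensorDegree 𝒜 k :=
  koszulSign_mem (comul_mem ha)

theorem superComul_mul (h : IsSuperCommutative 𝒜) {j : ZMod 2} (a : A) {b : A} (hb : b ∈ 𝒜 j) :
    superComul 𝒜 (a * b) = twistedMul 𝒜 j (superComul 𝒜 a) (superComul 𝒜 b) := by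
  refine Eq.trans ?_ (koszulSign_mul h (Coalgebra.comul a) (comul_mem hb))
  exact congrArg (fun t => koszulSign 𝒜 ((GradedTensorProduct.of K 𝒜 𝒜).symm t))
    (HopfSuperalgebra.comul_mul (𝒜 := 𝒜) a b)

theorem superComul_one : superComul 𝒜 (1 : A) = 1 := by
  have h : (Coalgebra.comul (1 : A) : A ⊗[K] A) = 1 :=
    (GradedTensorProduct.of K 𝒜 𝒜).injective (HopfSuperalgebra.comul_one (𝒜 := 𝒜))
  rw [superComul, LinearMap.comp_apply, h]
  exact koszulSign_tmul_even 1 (SetLike.one_mem_graded 𝒜)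

theorem counit_parity (x : A) : Coalgebra.counit (R := K) (parity 𝒜 x) = Coalgebra.counit x := by
  induction x using super_induction (𝒜 := 𝒜) with
  | heven x hx => simp [hx]
  | hodd x hx => simp [hx, HopfSuperalgebra.counit_odd x hx]
  | hadd x y hx hy => simp [hx, hy]

theorem rTensor_counit_superComul (a : A) :
    (Coalgebra.counit (R := K)).rTensor A (superComul 𝒜 a) = 1 ⊗ₜ a := by
  rw [← Coalgebra.rTensor_counit_comul, superComul, LinearMap.comp_apply]
  induction (Coalgebra.comul a : A ⊗[K] A) using tensor_induction (𝒜 := 𝒜) with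
  | hadd s t hs ht => simp only [map_add, hs, ht]
  | htmul i j x hx y hy =>
    obtain rfl | rfl := super_cases j
    · simp [koszulSign_tmul_even _ hy]
    · simp [koszulSign_tmul_odd _ hy, counit_parity]

theorem lTensor_counit_superComul (a : A) :
    (Coalgebra.counit (R := K)).lTensor A (superComul 𝒜 a) = a ⊗ₜ 1 := by
  rw [← Coalgebra.lTensor_counit_comul, superComul, LinearMap.comp_apply]
  induction (Coalgebra.comul a : A ⊗[K] A) using tensor_induction (𝒜 := 𝒜) with
  | hadd s t hs ht => simp only [map_add, hs, ht]
  | htmul i j x hx y hy =>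
    obtain rfl | rfl := super_cases j
    · simp [koszulSign_tmul_even _ hy]
    · simp [koszulSign_tmul_odd _ hy, HopfSuperalgebra.counit_odd y hy]

theorem comul_twist (j : ZMod 2) (x : A) :
    (Coalgebra.comul (twist 𝒜 j x) : A ⊗[K] A) =
      TensorProduct.map (twist 𝒜 j) (twist 𝒜 j) (Coalgebra.comul x) := by
  obtain rfl | rfl := super_cases j
  · simp
  · have h2 : ZMod.val (1 : ZMod 2) = 1 := rfl
    induction x using super_induction (𝒜 := 𝒜) with
    | hadd x y hx hy => simp only [map_add, hx, hy]
    | heven x hx => rw [tensorDegree_parity (comul_mem hx)]; simp [hx]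
    | hodd x hx => rw [tensorDegree_parity (comul_mem hx)]; simp [hx, h2]

theorem lTensor_superComul (t : A ⊗[K] A) :
    (superComul 𝒜).lTensor A (koszulSign 𝒜 t) =
      koszulSignThree 𝒜 (Coalgebra.comul.lTensor A t) := by
  induction t using tensor_induction (𝒜 := 𝒜) with
  | hadd s t hs ht => simp only [map_add, hs, ht]
  | htmul i j x hx y hy =>
    rw [koszulSign_tmul x hy, LinearMap.lTensor_tmul, LinearMap.lTensor_tmul, superComul,
      LinearMap.comp_apply]
    refine tensorDegree_induction (P := fun t => twist 𝒜 j x ⊗ₜ koszulSign 𝒜 t =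
      koszulSignThree 𝒜 (x ⊗ₜ t)) (comul_mem hy) ?_ ?_
    · intro k y hy z hz
      rw [koszulSign_tmul y hz, koszulSignThree_tmul x hy hz, add_sub_cancel]
    · intro s t hs ht
      simp only [map_add, TensorProduct.tmul_add, hs, ht]

theorem rTensor_superComul (t : A ⊗[K] A) :
    TensorProduct.assoc K A A A ((superComul 𝒜).rTensor A (koszulSign 𝒜 t)) =
      koszulSignThree 𝒜 (TensorProduct.assoc K A A A (Coalgebra.comul.rTensor A t)) := by
  induction t using tensor_induction (𝒜 := 𝒜) with
  | hadd s t hs ht => simp only [map_add, hs, ht]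
  | htmul i j x hx z hz =>
    rw [koszulSign_tmul x hz, LinearMap.rTensor_tmul, LinearMap.rTensor_tmul, superComul,
      LinearMap.comp_apply, comul_twist]
    induction (Coalgebra.comul x : A ⊗[K] A) using tensor_induction (𝒜 := 𝒜) with
    | hadd s t hs ht => simp only [map_add, TensorProduct.add_tmul, hs, ht]
    | htmul k l x hx y hy =>
      rw [TensorProduct.assoc_tmul, koszulSignThree_tmul x hy hz, TensorProduct.map_tmul,
        koszulSign_tmul _ (twist_mem j hy), TensorProduct.assoc_tmul, twist_twist]

/-- The sign for three factors, one term for each pair, factors as `|x|(|y|+|z|) + |y||z|` and as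
`(|x|+|y|)|z| + |x||y|`. Both iterates are thus `koszulSignThree` applied to the two sides of
ordinary coassociativity. -/
theorem superComul_coassoc (a : A) :
    TensorProduct.assoc K A A A ((superComul 𝒜).rTensor A (superComul 𝒜 a)) =
      (superComul 𝒜).lTensor A (superComul 𝒜 a) := by
  conv_lhs => rw [superComul]
  conv_rhs => rw [superComul]
  rw [LinearMap.comp_apply]
  exact (rTensor_superComul _).trans ((congrArg (koszulSignThree 𝒜)
    (Coalgebra.coassoc_apply a)).trans (lTensor_superComul _).symm)

end SuperComul

/-! ### The antipode is a multiplicative involution -/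

section Antipode

open WithConv

variable {K : Type*} [Field K] {A : Type*} [Ring A] [Algebra K A]
  {𝒜 : ZMod 2 → Submodule K A} [GradedAlgebra 𝒜] [Coalgebra K A] [HopfSuperalgebra 𝒜]

local notation "S" => HopfSuperalgebra.antipode 𝒜

theorem antipode_one : S (1 : A) = 1 := by
  have h : (Coalgebra.comul (1 : A) : A ⊗[K] A) = 1 :=
    (GradedTensorProduct.of K 𝒜 𝒜).injective (HopfSuperalgebra.comul_one (𝒜 := 𝒜))
  have := HopfSuperalgebra.mul_antipode_rTensor_comul (𝒜 := 𝒜) (1 : A)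
  rw [h, Algebra.TensorProduct.one_def] at this
  simpa [HopfSuperalgebra.counit_one (𝒜 := 𝒜)] using this

theorem antipode_twist (j : ZMod 2) (x : A) : S (twist 𝒜 j x) = twist 𝒜 j (S x) := by
  obtain rfl | rfl := super_cases j
  · simp
  · induction x using super_induction (𝒜 := 𝒜) with
    | hadd x y hx hy => simp only [map_add, hx, hy]
    | heven x hx => simp [hx, HopfSuperalgebra.antipode_mem 0 x hx]
    | hodd x hx => simp [hx, HopfSuperalgebra.antipode_mem 1 x hx]

omit [Coalgebra K A] [HopfSuperalgebra 𝒜] in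
theorem twist_mul (j : ZMod 2) (x y : A) : twist 𝒜 j (x * y) = twist 𝒜 j x * twist 𝒜 j y := by
  obtain rfl | rfl := super_cases j <;> simp [parity_mul]

/-- The sign built into `superComul` is the one produced by exchanging `S(a₁)` and `a₂`. -/
theorem mul_comm_antipode_superComul (h : IsSuperCommutative 𝒜) (a : A) :
    LinearMap.mul' K A (TensorProduct.comm K A A ((S).rTensor A (superComul 𝒜 a))) =
      algebraMap K A (Coalgebra.counit a) := by
  rw [← HopfSuperalgebra.mul_antipode_rTensor_comul (𝒜 := 𝒜) a, superComul, LinearMap.comp_apply]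
  induction (Coalgebra.comul a : A ⊗[K] A) using tensor_induction (𝒜 := 𝒜) with
  | hadd s t hs ht => simp only [map_add, hs, ht]
  | htmul i j x hx y hy =>
    rw [koszulSign_tmul x hy, LinearMap.rTensor_tmul, LinearMap.rTensor_tmul,
      TensorProduct.comm_tmul, LinearMap.mul'_apply, LinearMap.mul'_apply, antipode_twist,
      ← h.mul_eq _ hy]

variable (𝒜) in
/-- The pairing `(x ⊗ y, b) ↦ S(x b) σ^{|b|}(y)`. -/
noncomputable def antipodeAux : A ⊗[K] A →ₗ[K] A →ₗ[K] A :=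
  TensorProduct.lift <| LinearMap.mk₂ K (fun x y =>
      LinearMap.mulRight K y ∘ₗ (S) ∘ₗ LinearMap.mulLeft K x ∘ₗ superProj 𝒜 0 +
      LinearMap.mulRight K (parity 𝒜 y) ∘ₗ (S) ∘ₗ LinearMap.mulLeft K x ∘ₗ superProj 𝒜 1)
    (fun x x' y => by ext; simp [add_mul]; abel)
    (fun c x y => by ext; simp)
    (fun x y y' => by ext; simp [mul_add]; abel)
    (fun c x y => by ext; simp)

theorem antipodeAux_tmul (x y : A) {j : ZMod 2} {b : A} (hb : b ∈ 𝒜 j) :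
    antipodeAux 𝒜 (x ⊗ₜ y) b = S (x * b) * twist 𝒜 j y := by
  obtain rfl | rfl := super_cases j <;> simp [antipodeAux, hb]

theorem mul_antipodeAux (s t : A ⊗[K] A) :
    LinearMap.mul' K A ((antipodeAux 𝒜 s).rTensor A t) =
      LinearMap.mul' K A ((S).rTensor A ((GradedTensorProduct.of K 𝒜 𝒜).symm
        (GradedTensorProduct.of K 𝒜 𝒜 s * GradedTensorProduct.of K 𝒜 𝒜 t))) := by
  induction s using tensor_induction (𝒜 := 𝒜) with
  | hadd s s' hs hs' =>
    simp only [map_add, add_mul, LinearMap.rTensor_add, LinearMap.add_apply, hs, hs']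
  | htmul i j x hx y hy =>
    induction t using tensor_induction (𝒜 := 𝒜) with
    | hadd s t hs ht => simp only [map_add, mul_add, hs, ht]
    | htmul k l x' hx' y' hy' =>
      rw [graded_tmul_mul_tmul x y' hy hx', GradedTensorProduct.of_symm_of, LinearMap.rTensor_tmul,
        LinearMap.rTensor_tmul, LinearMap.mul'_apply, LinearMap.mul'_apply,
        antipodeAux_tmul x y hx', mul_assoc]
      obtain rfl | rfl := super_cases j <;> obtain rfl | rfl := super_cases k <;> simp [hy, hx']

theorem conv_antipode : toConv LinearMap.id * toConv (S) = (1 : WithConv (A →ₗ[K] A)) := by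
  ext a
  simpa [LinearMap.lTensor_def] using HopfSuperalgebra.mul_antipode_lTensor_comul (𝒜 := 𝒜) a

theorem antipode_conv : toConv (S) * toConv LinearMap.id = (1 : WithConv (A →ₗ[K] A)) := by
  ext a
  simpa [LinearMap.rTensor_def] using HopfSuperalgebra.mul_antipode_rTensor_comul (𝒜 := 𝒜) a

/-- As a function of `b`, convolving the left side with the identity gives `ε(ab) = ε(a) ε(b)`; then
the identity is cancelled by its convolution inverse `S`. -/
theorem antipodeAux_comul (a b : A) :
    antipodeAux 𝒜 (Coalgebra.comul a) b = Coalgebra.counit (R := K) a • S b := by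
  have h : toConv (antipodeAux 𝒜 (Coalgebra.comul a)) * toConv LinearMap.id =
      Coalgebra.counit (R := K) a • (1 : WithConv (A →ₗ[K] A)) := by
    ext b
    have := mul_antipodeAux (𝒜 := 𝒜) (Coalgebra.comul a) (Coalgebra.comul b)
    rw [← HopfSuperalgebra.comul_mul, GradedTensorProduct.of_symm_of,
      HopfSuperalgebra.mul_antipode_rTensor_comul, HopfSuperalgebra.counit_mul (𝒜 := 𝒜)] at this
    simpa [LinearMap.rTensor_def, Algebra.smul_def] using this
  have h2 : toConv (antipodeAux 𝒜 (Coalgebra.comul a)) =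
      Coalgebra.counit (R := K) a • toConv (S) := by
    rw [← mul_one (toConv (antipodeAux 𝒜 (Coalgebra.comul a))), ← conv_antipode (𝒜 := 𝒜),
      ← mul_assoc, h, smul_mul_assoc, one_mul]
  exact congrArg (fun f : WithConv (A →ₗ[K] A) => f.ofConv b) h2

/-- For fixed homogeneous `b`, `antipodeAux_comul` is a convolution identity in `a`, from which
`σ^{|b|}` is cancelled by its inverse `σ^{|b|} ∘ S`. This yields `S(b) σ^{|b|}(S(a))`, which
supercommutativity rewrites as `S(a) S(b)`. -/
theorem antipode_mul (h : IsSuperCommutative 𝒜) (a b : A) : S (a * b) = S a * S b := by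
  have key : ∀ j, ∀ b ∈ 𝒜 j, S (a * b) = S a * S b := by
    intro j b hb
    rw [h.mul_eq _ (HopfSuperalgebra.antipode_mem j b hb)]
    have h1 : toConv ((S) ∘ₗ LinearMap.mulRight K b) * toConv (twist 𝒜 j) =
        toConv (LinearMap.toSpanSingleton K A (S b) ∘ₗ Coalgebra.counit) := by
      ext a
      have := antipodeAux_comul (𝒜 := 𝒜) a b
      rw [LinearMap.convMul_apply]
      refine Eq.trans ?_ this
      induction (Coalgebra.comul a : A ⊗[K] A) with
      | zero => simp
      | add s t hs ht => simp only [map_add, LinearMap.add_apply, hs, ht]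
      | tmul x y => rw [antipodeAux_tmul x y hb]; simp
    have h2 : toConv (twist 𝒜 j) * toConv (twist 𝒜 j ∘ₗ (S)) = (1 : WithConv (A →ₗ[K] A)) := by
      ext a
      have h3 : twist 𝒜 j (1 : A) = 1 := by
        obtain rfl | rfl := super_cases j <;> simp [SetLike.one_mem_graded 𝒜]
      rw [LinearMap.convMul_apply, LinearMap.convOne_apply, ← mul_one (algebraMap K A _), ← h3,
        ← Algebra.smul_def, ← map_smul, Algebra.smul_def, mul_one,
        ← HopfSuperalgebra.mul_antipode_lTensor_comul (𝒜 := 𝒜) a]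
      induction (Coalgebra.comul a : A ⊗[K] A) with
      | zero => simp
      | add s t hs ht => simp only [map_add, hs, ht]
      | tmul x y => simp [twist_mul]
    have h3 : toConv ((S) ∘ₗ LinearMap.mulRight K b) =
        toConv (LinearMap.toSpanSingleton K A (S b) ∘ₗ Coalgebra.counit) *
          toConv (twist 𝒜 j ∘ₗ (S)) := by
      rw [← h1, mul_assoc, h2, mul_one]
    have h4 := congrArg (fun f : WithConv (A →ₗ[K] A) => f.ofConv a) h3
    refine h4.trans ?_
    change (LinearMap.mul' K A) (TensorProduct.map
      (LinearMap.toSpanSingleton K A (S b) ∘ₗ Coalgebra.counit) (twist 𝒜 j ∘ₗ (S))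
        (Coalgebra.comul a)) = _
    have h5 : TensorProduct.map (LinearMap.toSpanSingleton K A (S b) ∘ₗ Coalgebra.counit)
        (twist 𝒜 j ∘ₗ (S)) = TensorProduct.map (LinearMap.toSpanSingleton K A (S b))
          (twist 𝒜 j ∘ₗ (S)) ∘ₗ (Coalgebra.counit (R := K) (A := A)).rTensor A := by
      ext; simp
    rw [h5, LinearMap.comp_apply, Coalgebra.rTensor_counit_comul]
    simp
  induction b using super_induction (𝒜 := 𝒜) with
  | hadd x y hx hy => simp only [map_add, mul_add, hx, hy]
  | heven b hb => exact key 0 b hb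
  | hodd b hb => exact key 1 b hb

/-- By multiplicativity `S ∘ S` is a left convolution inverse of `S`, and the identity is a right
one. -/
theorem antipode_antipode (h : IsSuperCommutative 𝒜) (a : A) : S (S a) = a := by
  have h1 : toConv ((S) ∘ₗ (S)) * toConv (S) = (1 : WithConv (A →ₗ[K] A)) := by
    ext a
    rw [LinearMap.convMul_apply, LinearMap.convOne_apply, ← mul_one (algebraMap K A _),
      ← antipode_one (𝒜 := 𝒜), ← Algebra.smul_def, ← map_smul, Algebra.smul_def, mul_one,
      ← HopfSuperalgebra.mul_antipode_rTensor_comul (𝒜 := 𝒜) a]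
    induction (Coalgebra.comul a : A ⊗[K] A) with
    | zero => simp
    | add s t hs ht => simp only [map_add, hs, ht]
    | tmul x y => simp [antipode_mul h]
  have h2 : toConv ((S) ∘ₗ (S)) = toConv LinearMap.id := by
    rw [← mul_one (toConv ((S) ∘ₗ (S))), ← antipode_conv (𝒜 := 𝒜), ← mul_assoc, h1, one_mul]
  exact congrArg (fun f : WithConv (A →ₗ[K] A) => f.ofConv a) h2

end Antipode

/-! ### The coaction on a coideal subalgebra -/

section Coideal

variable {K : Type*} [Field K] {A : Type*} [Ring A] [Algebra K A]
  {𝒜 : ZMod 2 → Submodule K A} [GradedAlgebra 𝒜] [Coalgebra K A] {B : Subalgebra K A}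

namespace IsLeftCoidealSupersubalgebra

/-- The projection of `B` onto its component of degree `i`. -/
noncomputable def proj (hB : IsLeftCoidealSupersubalgebra 𝒜 B) (i : ZMod 2) : B →ₗ[K] B where
  toFun b := ⟨superProj 𝒜 i b, hB.component_mem b b.2 i⟩
  map_add' x y := Subtype.ext (by simp)
  map_smul' c x := Subtype.ext (by simp)

theorem coe_proj (hB : IsLeftCoidealSupersubalgebra 𝒜 B) (i : ZMod 2) (b : B) :
    (hB.proj i b : A) = superProj 𝒜 i b := rfl

theorem proj_zero_add_proj_one (hB : IsLeftCoidealSupersubalgebra 𝒜 B) (b : B) :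
    hB.proj 0 b + hB.proj 1 b = b :=
  Subtype.ext (_root_.proj_zero_add_proj_one (b : A))

theorem proj_of_mem (hB : IsLeftCoidealSupersubalgebra 𝒜 B) {i j : ZMod 2} {b : B}
    (hb : (b : A) ∈ 𝒜 i) : hB.proj j b = if i = j then b else 0 := by
  refine Subtype.ext ((superProj_of_mem hb).trans ?_)
  split_ifs <;> rfl

theorem induction {P : B → Prop} (hB : IsLeftCoidealSupersubalgebra 𝒜 B) (b : B)
    (hhom : ∀ i (b : B), (b : A) ∈ 𝒜 i → P b) (hadd : ∀ b c, P b → P c → P (b + c)) : P b := by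
  rw [← hB.proj_zero_add_proj_one b]
  exact hadd _ _ (hhom 0 _ (proj_mem 0 _)) (hhom 1 _ (proj_mem 1 _))

omit [Coalgebra K A] in
theorem lTensor_val_injective (M : Type*) [AddCommGroup M] [Module K M] (B : Subalgebra K A) :
    Function.Injective (B.val.toLinearMap.lTensor M) :=
  Module.Flat.lTensor_preserves_injective_linearMap _ Subtype.val_injective

theorem superComul_mem_range (hB : IsLeftCoidealSupersubalgebra 𝒜 B) (b : B) :
    superComul 𝒜 (b : A) ∈ LinearMap.range (B.val.toLinearMap.lTensor A) := by
  obtain ⟨t, ht⟩ := hB.comul_mem b b.2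
  rw [superComul, LinearMap.comp_apply, ← ht]
  clear ht
  induction t with
  | zero => simp
  | add s t hs ht => simp only [map_add]; exact add_mem hs ht
  | tmul x c =>
    refine ⟨x ⊗ₜ hB.proj 0 c + parity 𝒜 x ⊗ₜ hB.proj 1 c, ?_⟩
    simp [koszulSign]
    rfl

/-- The coaction `B → A ⊗ B` given by `superComul`. -/
noncomputable def coaction (hB : IsLeftCoidealSupersubalgebra 𝒜 B) : B →ₗ[K] A ⊗[K] B :=
  (LinearEquiv.ofInjective _ (lTensor_val_injective A B)).symm.toLinearMap ∘ₗ
    (superComul 𝒜 ∘ₗ B.val.toLinearMap).codRestrict _ hB.superComul_mem_range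

theorem lTensor_coaction (hB : IsLeftCoidealSupersubalgebra 𝒜 B) (b : B) :
    B.val.toLinearMap.lTensor A (hB.coaction b) = superComul 𝒜 (b : A) :=
  congrArg Subtype.val (LinearEquiv.apply_symm_apply
    (LinearEquiv.ofInjective _ (lTensor_val_injective A B)) _)

variable [HopfSuperalgebra 𝒜]

theorem coaction_one (hB : IsLeftCoidealSupersubalgebra 𝒜 B) : hB.coaction 1 = 1 ⊗ₜ 1 := by
  apply lTensor_val_injective A B
  rw [hB.lTensor_coaction]
  simpa [Algebra.TensorProduct.one_def] using superComul_one (𝒜 := 𝒜)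

theorem lTensor_counit_coaction (hB : IsLeftCoidealSupersubalgebra 𝒜 B) (b : B) :
    (Coalgebra.counit (R := K) ∘ₗ B.val.toLinearMap).lTensor A (hB.coaction b) = (b : A) ⊗ₜ 1 := by
  rw [LinearMap.lTensor_comp, LinearMap.comp_apply, hB.lTensor_coaction, lTensor_counit_superComul]

theorem coaction_coassoc (hB : IsLeftCoidealSupersubalgebra 𝒜 B) (b : B) :
    TensorProduct.assoc K A A B ((superComul 𝒜).rTensor B (hB.coaction b)) =
      hB.coaction.lTensor A (hB.coaction b) := by
  apply Module.Flat.lTensor_preserves_injective_linearMap (M := A) _ (lTensor_val_injective A B)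
  have h1 : ∀ t : A ⊗[K] B, (B.val.toLinearMap.lTensor A).lTensor A
      (TensorProduct.assoc K A A B ((superComul 𝒜).rTensor B t)) =
      TensorProduct.assoc K A A A ((superComul 𝒜).rTensor A (B.val.toLinearMap.lTensor A t)) := by
    intro t
    induction t with
    | zero => simp
    | add s t hs ht => simp only [map_add, hs, ht]
    | tmul x c =>
      simp only [LinearMap.rTensor_tmul, LinearMap.lTensor_tmul]
      induction superComul 𝒜 x with
      | zero => simp
      | add s t hs ht => simp only [map_add, TensorProduct.add_tmul, hs, ht]
      | tmul x y => simp
  have h2 : ∀ t : A ⊗[K] B, (B.val.toLinearMap.lTensor A).lTensor A (hB.coaction.lTensor A t) =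
      (superComul 𝒜).lTensor A (B.val.toLinearMap.lTensor A t) := by
    intro t
    induction t with
    | zero => simp
    | add s t hs ht => simp only [map_add, hs, ht]
    | tmul x c => simp [hB.lTensor_coaction]
  rw [h1, h2, hB.lTensor_coaction, superComul_coassoc]

/-- The coaction preserves degree, so only homogeneous tensors of total degree `j` need to be
considered. -/
theorem coaction_induction (hB : IsLeftCoidealSupersubalgebra 𝒜 B) {j : ZMod 2} {b : B}
    (hb : (b : A) ∈ 𝒜 j) {P : A ⊗[K] B → Prop}
    (htmul : ∀ l, ∀ x ∈ 𝒜 l, ∀ c : B, (c : A) ∈ 𝒜 (j - l) → P (x ⊗ₜ c))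
    (hadd : ∀ s t, P s → P t → P (s + t)) : P (hB.coaction b) := by
  have h0 : P 0 := by simpa using htmul 0 0 (zero_mem _) 0 (zero_mem _)
  have hsplit : hB.coaction b =
      TensorProduct.map (superProj 𝒜 0) (hB.proj (j - 0)) (hB.coaction b) +
      TensorProduct.map (superProj 𝒜 1) (hB.proj (j - 1)) (hB.coaction b) := by
    apply lTensor_val_injective A B
    have h1 : ∀ l m, ∀ t : A ⊗[K] B, B.val.toLinearMap.lTensor A
        (TensorProduct.map (superProj 𝒜 l) (hB.proj m) t) =
        TensorProduct.map (superProj 𝒜 l) (superProj 𝒜 m) (B.val.toLinearMap.lTensor A t) := by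
      intro l m t
      induction t with
      | zero => simp
      | add s t hs ht => simp only [map_add, hs, ht]
      | tmul x c => simp [coe_proj]
    rw [map_add, h1, h1, hB.lTensor_coaction]
    refine tensorDegree_induction (P := fun t => t =
      TensorProduct.map (superProj 𝒜 0) (superProj 𝒜 (j - 0)) t +
        TensorProduct.map (superProj 𝒜 1) (superProj 𝒜 (j - 1)) t) (superComul_mem hb) ?_ ?_
    · intro i x hx y hy
      obtain rfl | rfl := super_cases i <;>
        simp [superProj_of_mem hx, superProj_of_mem hy]
    · intro s t hs ht
      conv_lhs => rw [hs, ht]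
      simp only [map_add]
      abel
  have hmap : ∀ l, ∀ t : A ⊗[K] B, P (TensorProduct.map (superProj 𝒜 l) (hB.proj (j - l)) t) := by
    intro l t
    induction t with
    | zero => simpa using h0
    | add s t hs ht => rw [map_add]; exact hadd _ _ hs ht
    | tmul x c => exact htmul l _ (proj_mem l x) _ (proj_mem (j - l) (c : A))
  rw [hsplit]
  exact hadd _ _ (hmap 0 _) (hmap 1 _)

theorem coaction_mul (hA : IsSuperCommutative 𝒜) (hB : IsLeftCoidealSupersubalgebra 𝒜 B)
    {j : ZMod 2} (b : B) {c : B} (hc : (c : A) ∈ 𝒜 j) :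
    hB.coaction (b * c) = TensorProduct.map₂ ((LinearMap.mul K A).flip ∘ₗ twist 𝒜 j)
      (LinearMap.mul K B) (hB.coaction b) (hB.coaction c) := by
  apply lTensor_val_injective A B
  have h1 : ∀ s t : A ⊗[K] B, B.val.toLinearMap.lTensor A
      (TensorProduct.map₂ ((LinearMap.mul K A).flip ∘ₗ twist 𝒜 j) (LinearMap.mul K B) s t) =
      twistedMul 𝒜 j (B.val.toLinearMap.lTensor A s) (B.val.toLinearMap.lTensor A t) := by
    intro s t
    induction s with
    | zero => simp
    | add s s' hs hs' => simp only [map_add, LinearMap.add_apply, hs, hs']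
    | tmul x b =>
      induction t with
      | zero => simp
      | add s t hs ht => simp only [map_add, hs, ht]
      | tmul y c => simp
  rw [h1, hB.lTensor_coaction, hB.lTensor_coaction, hB.lTensor_coaction]
  exact superComul_mul hA _ hc

end IsLeftCoidealSupersubalgebra

end Coideal

/-! ### The diagonal action and the free coaction on `A ⊗ Y` -/

section DiagonalAction

variable {K : Type*} [Field K] {A : Type*} [Ring A] [Algebra K A]
  {𝒜 : ZMod 2 → Submodule K A} [GradedAlgebra 𝒜] [Coalgebra K A] {B : Subalgebra K A}
  {Y : Type*} [AddCommGroup Y] [Module K Y]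

/-- Left multiplication on `A` combined with a family of operators on `Y`. -/
noncomputable def mulTensorAction (r : B →ₗ[K] Module.End K Y) :
    A ⊗[K] B →ₗ[K] Module.End K (A ⊗[K] Y) :=
  TensorProduct.homTensorHomMap (RingHom.id K) A Y A Y ∘ₗ TensorProduct.map (LinearMap.mul K A) r

omit [Coalgebra K A] in
@[simp] theorem mulTensorAction_tmul (r : B →ₗ[K] Module.End K Y) (x : A) (c : B) (a : A) (y : Y) :
    mulTensorAction r (x ⊗ₜ c) (a ⊗ₜ y) = (x * a) ⊗ₜ r c y := by
  simp [mulTensorAction]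

variable (r : B →ₗ[K] Module.End K Y)

namespace IsLeftCoidealSupersubalgebra

/-- The right action `(a ⊗ y) b = ∑ b₁ σ^{|b|}(a) ⊗ y b₂` of `B` on `A ⊗ Y`. -/
noncomputable def diagonalAction (hB : IsLeftCoidealSupersubalgebra 𝒜 B) :
    B →ₗ[K] Module.End K (A ⊗[K] Y) :=
  mulTensorAction r ∘ₗ hB.coaction ∘ₗ hB.proj 0 +
    LinearMap.lcomp K (A ⊗[K] Y) ((parity 𝒜).rTensor Y) ∘ₗ
      mulTensorAction r ∘ₗ hB.coaction ∘ₗ hB.proj 1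

theorem diagonalAction_apply (hB : IsLeftCoidealSupersubalgebra 𝒜 B) {j : ZMod 2} {b : B}
    (hb : (b : A) ∈ 𝒜 j) (m : A ⊗[K] Y) :
    hB.diagonalAction r b m = mulTensorAction r (hB.coaction b) ((twist 𝒜 j).rTensor Y m) := by
  obtain rfl | rfl := super_cases j <;> simp [diagonalAction, hB.proj_of_mem hb]

variable [HopfSuperalgebra 𝒜]

theorem diagonalAction_one (hB : IsLeftCoidealSupersubalgebra 𝒜 B) (hr : r 1 = 1) :
    hB.diagonalAction r 1 = 1 := by
  ext a y
  have := hB.diagonalAction_apply r (b := 1) (j := 0) (SetLike.one_mem_graded 𝒜) (a ⊗ₜ y)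
  simp [this, hB.coaction_one, hr]

theorem diagonalAction_mul (hA : IsSuperCommutative 𝒜) (hB : IsLeftCoidealSupersubalgebra 𝒜 B)
    (hr : ∀ b c, r (b * c) = r c * r b) (b c : B) :
    hB.diagonalAction r (b * c) = hB.diagonalAction r c * hB.diagonalAction r b := by
  refine hB.induction (P := fun b => hB.diagonalAction r (b * c) = hB.diagonalAction r c *
    hB.diagonalAction r b) b (fun i b hb => ?_) fun b b' h h' => by
      rw [add_mul, map_add, map_add, h, h', mul_add]
  refine hB.induction (P := fun c => hB.diagonalAction r (b * c) = hB.diagonalAction r c *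
    hB.diagonalAction r b) c (fun j c hc => ?_) fun c c' h h' => by
      rw [mul_add, map_add, map_add, h, h', add_mul]
  have hbc : ((b * c : B) : A) ∈ 𝒜 (i + j) := SetLike.mul_mem_graded (A := 𝒜) hb hc
  ext a y
  simp only [TensorProduct.AlgebraTensorModule.curry_apply, LinearMap.restrictScalars_self,
    TensorProduct.curry_apply, Module.End.mul_apply]
  rw [hB.diagonalAction_apply r hbc, hB.diagonalAction_apply r hb, hB.diagonalAction_apply r hc,
    hB.coaction_mul hA b hc, LinearMap.rTensor_tmul, LinearMap.rTensor_tmul]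
  induction hB.coaction b with
  | zero => simp
  | add s t hs ht => simp only [map_add, LinearMap.add_apply, hs, ht]
  | tmul x b =>
    induction hB.coaction c with
    | zero => simp
    | add s t hs ht => simp only [map_add, LinearMap.add_apply, hs, ht]
    | tmul x' c => simp [hr, twist_mul, twist_twist, mul_assoc, add_comm i j]

theorem superComul_twist (j : ZMod 2) (x : A) :
    superComul 𝒜 (twist 𝒜 j x) = TensorProduct.map (twist 𝒜 j) (twist 𝒜 j) (superComul 𝒜 x) := by
  rw [superComul, LinearMap.comp_apply, LinearMap.comp_apply, comul_twist]
  induction (Coalgebra.comul x : A ⊗[K] A) using tensor_induction (𝒜 := 𝒜) with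
  | hadd s t hs ht => simp only [map_add, hs, ht]
  | htmul k l x hx y hy =>
    rw [TensorProduct.map_tmul, koszulSign_tmul _ (twist_mem j hy), koszulSign_tmul _ hy,
      TensorProduct.map_tmul, twist_twist, twist_twist, add_comm]

variable (𝒜 Y) in
/-- The coaction of `A` on `A ⊗ Y` through the first factor. -/
noncomputable def freeCoaction : A ⊗[K] Y →ₗ[K] A ⊗[K] (A ⊗[K] Y) :=
  (TensorProduct.assoc K A A Y).toLinearMap ∘ₗ (superComul 𝒜).rTensor Y

/-- This makes `A ⊗ Y` a Hopf module. It combines multiplicativity of `superComul` with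
coassociativity of the coaction on `B`. -/
theorem freeCoaction_diagonalAction (hA : IsSuperCommutative 𝒜)
    (hB : IsLeftCoidealSupersubalgebra 𝒜 B) (b : B) (m : A ⊗[K] Y) :
    freeCoaction 𝒜 Y (hB.diagonalAction r b m) =
      hB.diagonalAction (hB.diagonalAction r) b (freeCoaction 𝒜 Y m) := by
  refine hB.induction (P := fun b => freeCoaction 𝒜 Y (hB.diagonalAction r b m) =
      hB.diagonalAction (hB.diagonalAction r) b (freeCoaction 𝒜 Y m)) b
    (fun j b hb => ?_) fun b b' h h' => by
    simp only [map_add, LinearMap.add_apply, h, h']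
  have key : ∀ i, ∀ a ∈ 𝒜 i, ∀ y : Y, freeCoaction 𝒜 Y (hB.diagonalAction r b (a ⊗ₜ y)) =
      hB.diagonalAction (hB.diagonalAction r) b (freeCoaction 𝒜 Y (a ⊗ₜ y)) := by
    intro i a ha y
    -- Both sides are evaluations of `G` on a twice iterated coaction of `b`: the left side
    -- comultiplies the factor in `A`, the right side coacts on the factor in `B`.
    let G : A ⊗[K] (A ⊗[K] B) →ₗ[K] A ⊗[K] (A ⊗[K] Y) :=
      (TensorProduct.assoc K A A Y).toLinearMap ∘ₗ
      TensorProduct.map ((twistedMul 𝒜 i).flip (superComul 𝒜 (twist 𝒜 j a)))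
        (LinearMap.applyₗ y ∘ₗ r) ∘ₗ (TensorProduct.assoc K A A B).symm.toLinearMap
    have h1 : ∀ t : A ⊗[K] B, freeCoaction 𝒜 Y (mulTensorAction r t (twist 𝒜 j a ⊗ₜ y)) =
        G (TensorProduct.assoc K A A B ((superComul 𝒜).rTensor B t)) := by
      intro t
      induction t with
      | zero => simp
      | add s t hs ht => simp only [map_add, LinearMap.add_apply, hs, ht]
      | tmul x c => simp [freeCoaction, G, superComul_mul hA x (twist_mem j ha)]
    rw [hB.diagonalAction_apply r hb, hB.diagonalAction_apply _ hb, LinearMap.rTensor_tmul, h1,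
      hB.coaction_coassoc]
    refine hB.coaction_induction hb (P := fun t => G (hB.coaction.lTensor A t) =
      mulTensorAction (hB.diagonalAction r) t ((twist 𝒜 j).rTensor _
        (freeCoaction 𝒜 Y (a ⊗ₜ y)))) ?_ fun s t hs ht => by
          simp only [map_add, LinearMap.add_apply, hs, ht]
    intro l x hx c hc
    simp only [LinearMap.lTensor_tmul, G, freeCoaction, superComul_twist, LinearMap.comp_apply,
      LinearMap.rTensor_tmul, LinearEquiv.coe_coe]
    refine tensorDegree_induction (P := fun t => (TensorProduct.assoc K A A Y)
      (TensorProduct.map ((twistedMul 𝒜 i).flip (TensorProduct.map (twist 𝒜 j) (twist 𝒜 j) t))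
        (LinearMap.applyₗ y ∘ₗ r) ((TensorProduct.assoc K A A B).symm (x ⊗ₜ hB.coaction c))) =
      mulTensorAction (hB.diagonalAction r) (x ⊗ₜ c) ((twist 𝒜 j).rTensor _
        (TensorProduct.assoc K A A Y (t ⊗ₜ y)))) (superComul_mem ha) ?_ ?_
    · intro p a₁ ha₁ a₂ ha₂
      rw [TensorProduct.assoc_tmul, LinearMap.rTensor_tmul, mulTensorAction_tmul,
        hB.diagonalAction_apply r hc, LinearMap.rTensor_tmul]
      induction hB.coaction c with
      | zero => simp
      | add s t hs ht => simp only [map_add, LinearMap.add_apply, TensorProduct.tmul_add, hs, ht]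
      | tmul x' c' =>
        have h3 : (-1 : ZMod 2) = 1 := rfl
        have h4 : (1 + 1 : ZMod 2) = 0 := rfl
        rw [hA.mul_eq x (twist_mem j ha₁)]
        clear hc ha h1 G
        obtain rfl | rfl := super_cases i <;> obtain rfl | rfl := super_cases j <;>
          obtain rfl | rfl := super_cases p <;> obtain rfl | rfl := super_cases l <;>
          simp_all [TensorProduct.neg_tmul, TensorProduct.tmul_neg]
    · intro s t hs ht
      simp only [map_add, TensorProduct.map_add_left, LinearMap.add_apply, TensorProduct.add_tmul,
        hs, ht]
  induction m with
  | zero => simp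
  | add m m' h h' => simp only [map_add, h, h']
  | tmul a y =>
    induction a using super_induction (𝒜 := 𝒜) with
    | hadd a a' h h' => simp only [TensorProduct.add_tmul, map_add, h, h']
    | heven a ha => exact key 0 a ha y
    | hodd a ha => exact key 1 a ha y

theorem counit_freeCoaction (m : A ⊗[K] Y) :
    TensorProduct.lid K _ ((Coalgebra.counit (R := K)).rTensor _ (freeCoaction 𝒜 Y m)) = m := by
  induction m with
  | zero => simp
  | add m m' h h' => simp only [map_add, h, h']
  | tmul a y =>
    have h : ∀ t : A ⊗[K] A, TensorProduct.lid K _ ((Coalgebra.counit (R := K)).rTensor _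
        (TensorProduct.assoc K A A Y (t ⊗ₜ y))) =
        TensorProduct.lid K _ ((Coalgebra.counit (R := K)).rTensor _ t) ⊗ₜ y := by
      intro t
      induction t with
      | zero => simp
      | add s t hs ht => simp only [map_add, TensorProduct.add_tmul, hs, ht]
      | tmul a a' => simp [TensorProduct.smul_tmul']
    rw [freeCoaction, LinearMap.comp_apply, LinearMap.rTensor_tmul, LinearEquiv.coe_coe, h,
      rTensor_counit_superComul]
    simp

theorem freeCoaction_coassoc (m : A ⊗[K] Y) :
    (freeCoaction 𝒜 Y).lTensor A (freeCoaction 𝒜 Y m) =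
      TensorProduct.assoc K A A (A ⊗[K] Y)
        ((superComul 𝒜).rTensor (A ⊗[K] Y) (freeCoaction 𝒜 Y m)) := by
  induction m with
  | zero => simp
  | add m m' h h' => simp only [map_add, h, h']
  | tmul a y =>
    have h1 : ∀ t : A ⊗[K] A, (freeCoaction 𝒜 Y).lTensor A (TensorProduct.assoc K A A Y (t ⊗ₜ y)) =
        ((TensorProduct.assoc K A A Y).toLinearMap ∘ₗ
          (TensorProduct.mk K (A ⊗[K] A) Y).flip y).lTensor A ((superComul 𝒜).lTensor A t) := by
      intro t
      induction t with
      | zero => simp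
      | add s t hs ht => simp only [map_add, TensorProduct.add_tmul, hs, ht]
      | tmul a a' => simp [freeCoaction]
    have h2 : ∀ t : A ⊗[K] A, TensorProduct.assoc K A A (A ⊗[K] Y)
        ((superComul 𝒜).rTensor (A ⊗[K] Y) (TensorProduct.assoc K A A Y (t ⊗ₜ y))) =
        ((TensorProduct.assoc K A A Y).toLinearMap ∘ₗ
          (TensorProduct.mk K (A ⊗[K] A) Y).flip y).lTensor A
            (TensorProduct.assoc K A A A ((superComul 𝒜).rTensor A t)) := by
      intro t
      induction t with
      | zero => simp
      | add s t hs ht => simp only [map_add, TensorProduct.add_tmul, hs, ht]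
      | tmul a a' =>
        simp only [TensorProduct.assoc_tmul, LinearMap.rTensor_tmul]
        induction superComul 𝒜 a with
        | zero => simp
        | add s t hs ht => simp only [map_add, TensorProduct.add_tmul, hs, ht]
        | tmul x x' => simp
    have h3 : freeCoaction 𝒜 Y (a ⊗ₜ y) = TensorProduct.assoc K A A Y (superComul 𝒜 a ⊗ₜ y) := by
      simp [freeCoaction]
    rw [h3, h1, h2, superComul_coassoc]

variable {Z : Type*} [AddCommGroup Z] [Module K Z]

omit [HopfSuperalgebra 𝒜] in
theorem lTensor_freeCoaction (g : Y →ₗ[K] Z) (m : A ⊗[K] Y) :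
    (g.lTensor A).lTensor A (freeCoaction 𝒜 Y m) = freeCoaction 𝒜 Z (g.lTensor A m) := by
  induction m with
  | zero => simp
  | add m m' h h' => simp only [map_add, h, h']
  | tmul a y =>
    simp only [freeCoaction, LinearMap.comp_apply, LinearMap.rTensor_tmul, LinearMap.lTensor_tmul,
      LinearEquiv.coe_coe]
    induction superComul 𝒜 a with
    | zero => simp
    | add s t hs ht => simp only [map_add, TensorProduct.add_tmul, hs, ht]
    | tmul x x' => simp

omit [Coalgebra K A] [HopfSuperalgebra 𝒜] in
theorem lTensor_mulTensorAction {r : B →ₗ[K] Module.End K Y} {r' : B →ₗ[K] Module.End K Z}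
    {g : Y →ₗ[K] Z} (hg : ∀ b y, g (r b y) = r' b (g y)) (t : A ⊗[K] B) (m : A ⊗[K] Y) :
    g.lTensor A (mulTensorAction r t m) = mulTensorAction r' t (g.lTensor A m) := by
  induction t with
  | zero => simp
  | add s t hs ht => simp only [map_add, LinearMap.add_apply, hs, ht]
  | tmul x c =>
    induction m with
    | zero => simp
    | add m m' h h' => simp only [map_add, h, h']
    | tmul a y => simp [hg]

omit [HopfSuperalgebra 𝒜] in
theorem lTensor_diagonalAction (hB : IsLeftCoidealSupersubalgebra 𝒜 B)
    {r : B →ₗ[K] Module.End K Y} {r' : B →ₗ[K] Module.End K Z}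
    {g : Y →ₗ[K] Z} (hg : ∀ b y, g (r b y) = r' b (g y)) (b : B) (m : A ⊗[K] Y) :
    g.lTensor A (hB.diagonalAction r b m) = hB.diagonalAction r' b (g.lTensor A m) := by
  refine hB.induction (P := fun b => g.lTensor A (hB.diagonalAction r b m) =
    hB.diagonalAction r' b (g.lTensor A m)) b (fun j b hb => ?_) fun b b' h h' => by
      simp only [map_add, LinearMap.add_apply, h, h']
  rw [hB.diagonalAction_apply r hb, hB.diagonalAction_apply r' hb, lTensor_mulTensorAction hg,
    ← LinearMap.comp_apply (g.lTensor A), LinearMap.lTensor_comp_rTensor,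
    ← LinearMap.rTensor_comp_lTensor, LinearMap.comp_apply]

/-- On vectors on which `B` acts through the counit modulo `ker q`, the diagonal action is the right
multiplication. -/
theorem lTensor_diagonalAction_of_counit (hA : IsSuperCommutative 𝒜)
    (hB : IsLeftCoidealSupersubalgebra 𝒜 B) (q : Y →ₗ[K] Z) {y : Y}
    (hy : ∀ b : B, q (r b y) = Coalgebra.counit (R := K) (b : A) • q y) (b : B) (a : A) :
    q.lTensor A (hB.diagonalAction r b (a ⊗ₜ y)) = (a * b) ⊗ₜ q y := by
  refine hB.induction (P := fun b => q.lTensor A (hB.diagonalAction r b (a ⊗ₜ y)) =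
    (a * b) ⊗ₜ q y) b (fun j b hb => ?_) fun b b' h h' => by
      rw [map_add, LinearMap.add_apply, map_add, h, h', Subalgebra.coe_add, mul_add,
        TensorProduct.add_tmul]
  have h1 : ∀ t : A ⊗[K] B, q.lTensor A (mulTensorAction r t (twist 𝒜 j a ⊗ₜ y)) =
      TensorProduct.map (LinearMap.mulRight K (twist 𝒜 j a)) (LinearMap.toSpanSingleton K Z (q y))
        ((Coalgebra.counit (R := K) ∘ₗ B.val.toLinearMap).lTensor A t) := by
    intro t
    induction t with
    | zero => simp
    | add s t hs ht => simp only [map_add, LinearMap.add_apply, hs, ht]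
    | tmul x c => simp [hy]
  rw [hB.diagonalAction_apply r hb, LinearMap.rTensor_tmul, h1, hB.lTensor_counit_coaction,
    hA.mul_eq a hb]
  simp

-- Expresses the operator without the parity twist through diagonal actions, the twist on odd
-- elements being undone by applying `σ` to `m`.
omit [HopfSuperalgebra 𝒜] in
theorem mulTensorAction_coaction (hB : IsLeftCoidealSupersubalgebra 𝒜 B) (b : B) (m : A ⊗[K] Y) :
    mulTensorAction r (hB.coaction b) m = hB.diagonalAction r (hB.proj 0 b) m +
      hB.diagonalAction r (hB.proj 1 b) ((parity 𝒜).rTensor Y m) := by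
  have h1 : (parity 𝒜) ∘ₗ parity 𝒜 = LinearMap.id := by ext; simp
  rw [hB.diagonalAction_apply r (proj_mem 0 _), hB.diagonalAction_apply r (proj_mem 1 _),
    twist_one, ← LinearMap.rTensor_comp_apply, h1, twist_zero, LinearMap.rTensor_id,
    LinearMap.id_apply, ← LinearMap.add_apply, ← map_add, ← map_add, hB.proj_zero_add_proj_one]

end IsLeftCoidealSupersubalgebra

end DiagonalAction

/-! ### Matrix inversion over `A` and `B` -/

section SuperSplit

theorem exists_isSuperSplit {K : Type u} {R : Type v} [Field K] [Ring R] [Algebra K R]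
    (E : Subalgebra K R)
    (O : Submodule K R) (central : ∀ z ∈ E, ∀ r, z * r = r * z)
    (anti : ∀ x ∈ O, ∀ y ∈ O, x * y = -(y * x)) (hK : (2 : K) ≠ 0)
    (even_mul_odd : ∀ z ∈ E, ∀ x ∈ O, z * x ∈ O)
    (decomp : ∀ r, ∃ z ∈ E, ∃ x ∈ O, r = z + x) (disjoint : ∀ z ∈ E, z ∈ O → z = 0) :
    ∃ (Z : Type v) (_ : CommRing Z) (f : Z →+* R),
      IsSuperSplit f O ∧ ∀ r, r ∈ E ↔ ∃ z, f z = r := by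
  let _ : CommRing E :=
    { (inferInstance : Ring E) with mul_comm := fun x y => Subtype.ext (central x x.2 y) }
  refine ⟨E, inferInstance, E.val.toRingHom, ⟨Subtype.val_injective, fun z r => central z z.2 r,
    anti, fun x hx => ?_, fun z x hx => even_mul_odd z z.2 x hx, fun r => ?_,
    fun z hz => disjoint z z.2 hz⟩, fun r => ⟨fun h => ⟨⟨r, h⟩, rfl⟩, ?_⟩⟩
  -- Characteristic different from two enters here: `x² = -x²` forces `x² = 0`.
  · have h := anti x hx x hx
    rw [eq_neg_iff_add_eq_zero, ← two_smul K] at h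
    exact (smul_eq_zero.1 h).resolve_left hK
  · obtain ⟨z, hz, x, hx, h⟩ := decomp r
    exact ⟨⟨z, hz⟩, x, hx, h⟩
  · rintro ⟨z, rfl⟩
    exact z.2

variable {K : Type*} [Field K] {A : Type*} [Ring A] [Algebra K A]
  {𝒜 : ZMod 2 → Submodule K A} [GradedAlgebra 𝒜]

variable (𝒜) in
/-- The even part of a superalgebra. -/
def evenSubalgebra : Subalgebra K A where
  carrier := 𝒜 0
  mul_mem' := even_mul_even
  add_mem' := (𝒜 0).add_mem
  algebraMap_mem' c := by
    rw [Algebra.algebraMap_eq_smul_one]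
    exact (𝒜 0).smul_mem c (SetLike.one_mem_graded 𝒜)

theorem eq_zero_of_even_of_odd {x : A} (h0 : x ∈ 𝒜 0) (h1 : x ∈ 𝒜 1) : x = 0 := by
  rw [← proj_zero_of_even h0, proj_zero_of_odd h1]

theorem IsSuperCommutative.exists_mul_eq_scalar (h : IsSuperCommutative 𝒜) (hK : (2 : K) ≠ 0)
    {n : Type*} [Fintype n] [DecidableEq n] {P Q : Matrix n n A} {s : A} (hs : s ∈ 𝒜 0)
    (hPQ : P * Q = Matrix.scalar n s) :
    ∃ (X : Matrix n n A) (k : ℕ), X * P = Matrix.scalar n (s ^ k) := by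
  obtain ⟨Z, _, f, hf, hE⟩ := exists_isSuperSplit (evenSubalgebra 𝒜) (𝒜 1)
    (fun z hz r => h.even_mul hz r) (fun x hx y hy => h.odd_mul_odd hx hy) hK
    (fun z hz x hx => even_mul_odd hz hx)
    (fun r => ⟨_, proj_mem 0 r, _, proj_mem 1 r, (proj_zero_add_proj_one r).symm⟩)
    (fun z hz hz' => eq_zero_of_even_of_odd hz hz')
  obtain ⟨z, rfl⟩ := (hE s).1 hs
  exact hf.exists_mul_eq_scalar_of_mul_eq_scalar P Q z hPQ

variable [Coalgebra K A] [HopfSuperalgebra 𝒜]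

variable (𝒜) in
/-- The counit as a character. -/
noncomputable def counitAlgHom : A →ₐ[K] K :=
  AlgHom.ofLinearMap Coalgebra.counit (HopfSuperalgebra.counit_one (𝒜 := 𝒜))
    (HopfSuperalgebra.counit_mul (𝒜 := 𝒜))

@[simp] theorem counitAlgHom_apply (a : A) :
    counitAlgHom 𝒜 a = Coalgebra.counit (R := K) a := rfl

theorem IsLeftCoidealSupersubalgebra.exists_one_sub_mul_eq_scalar (hA : IsSuperCommutative 𝒜)
    (hK : (2 : K) ≠ 0) {B : Subalgebra K A} (hB : IsLeftCoidealSupersubalgebra 𝒜 B)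
    {n : Type*} [Fintype n] [DecidableEq n] (C : Matrix n n B)
    (hC : ∀ i j, Coalgebra.counit (R := K) (C i j : A) = 0) :
    ∃ (Q : Matrix n n B) (s : B), (s : A) ∈ 𝒜 0 ∧ Coalgebra.counit (R := K) (s : A) = 1 ∧
      (1 - C) * Q = Matrix.scalar n s := by
  obtain ⟨Z, _, f, hf, hE⟩ := exists_isSuperSplit ((evenSubalgebra 𝒜).comap B.val)
    ((𝒜 1).comap B.val.toLinearMap)
    (fun z hz r => Subtype.ext (hA.even_mul hz r))
    (fun x hx y hy => Subtype.ext (hA.odd_mul_odd hx hy)) hK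
    (fun z hz x hx => even_mul_odd (𝒜 := 𝒜) hz hx)
    (fun r => ⟨_, proj_mem (𝒜 := 𝒜) 0 (r : A), _, proj_mem (𝒜 := 𝒜) 1 (r : A),
      (hB.proj_zero_add_proj_one r).symm⟩)
    (fun z hz hz' => Subtype.ext (eq_zero_of_even_of_odd (𝒜 := 𝒜) hz hz'))
  obtain ⟨Q, s, hs, hQ⟩ := hf.exists_one_sub_mul_eq_scalar ((counitAlgHom 𝒜).comp B.val)
    (fun x hx => HopfSuperalgebra.counit_odd (𝒜 := 𝒜) (x : A) hx) C hC
  exact ⟨Q, f s, (hE _).2 ⟨s, rfl⟩, hs, hQ⟩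

end SuperSplit

/-! ### Hopf modules and local finiteness -/

section HopfModule

variable {K : Type*} [Field K] {A : Type*} [Ring A] [Algebra K A]
  {𝒜 : ZMod 2 → Submodule K A} [GradedAlgebra 𝒜] [Coalgebra K A] {B : Subalgebra K A}
  {E : Type*} [AddCommGroup E] [Module K E] {F : Type*} [AddCommGroup F] [Module K F]

/-- A right action of `B` and a left coaction of `A` (through `superComul`) on `E` which are
compatible with the diagonal action. -/
structure IsHopfModule (hB : IsLeftCoidealSupersubalgebra 𝒜 B) (R : B →ₗ[K] Module.End K E)
    (ρ : E →ₗ[K] A ⊗[K] E) : Prop where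
  map_one : R 1 = 1
  map_mul : ∀ b c, R (b * c) = R c * R b
  counit : ∀ m, TensorProduct.lid K _ ((Coalgebra.counit (R := K)).rTensor _ (ρ m)) = m
  coassoc : ∀ m, ρ.lTensor A (ρ m) =
    TensorProduct.assoc K A A E ((superComul 𝒜).rTensor E (ρ m))
  compat : ∀ b m, ρ (R b m) = hB.diagonalAction R b (ρ m)

theorem isHopfModule_diagonalAction [HopfSuperalgebra 𝒜] (hA : IsSuperCommutative 𝒜)
    (hB : IsLeftCoidealSupersubalgebra 𝒜 B) {r : B →ₗ[K] Module.End K E} (h1 : r 1 = 1)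
    (hmul : ∀ b c, r (b * c) = r c * r b) :
    IsHopfModule hB (hB.diagonalAction r) (IsLeftCoidealSupersubalgebra.freeCoaction 𝒜 E) where
  map_one := hB.diagonalAction_one r h1
  map_mul := hB.diagonalAction_mul r hA hmul
  counit := IsLeftCoidealSupersubalgebra.counit_freeCoaction
  coassoc := IsLeftCoidealSupersubalgebra.freeCoaction_coassoc
  compat := IsLeftCoidealSupersubalgebra.freeCoaction_diagonalAction r hA hB

/-- A subspace is a subcomodule. -/
def IsSubcomodule (ρ : E →ₗ[K] A ⊗[K] E) (W : Submodule K E) : Prop :=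
  ∀ w ∈ W, ρ w ∈ LinearMap.range (W.subtype.lTensor A)

omit [Coalgebra K A] in
theorem range_lTensor_subtype_mono {V W : Submodule K E} (h : V ≤ W) :
    LinearMap.range (V.subtype.lTensor A) ≤ LinearMap.range (W.subtype.lTensor A) := by
  rw [← Submodule.subtype_comp_inclusion V W h, LinearMap.lTensor_comp]
  exact LinearMap.range_comp_le_range _ _

omit [Coalgebra K A] in
theorem IsSubcomodule.sup {ρ : E →ₗ[K] A ⊗[K] E} {V W : Submodule K E} (hV : IsSubcomodule ρ V)
    (hW : IsSubcomodule ρ W) : IsSubcomodule ρ (V ⊔ W) := by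
  intro x hx
  obtain ⟨v, hv, w, hw, rfl⟩ := Submodule.mem_sup.1 hx
  rw [map_add]
  exact add_mem (range_lTensor_subtype_mono le_sup_left (hV v hv))
    (range_lTensor_subtype_mono le_sup_right (hW w hw))

omit [Coalgebra K A] in
theorem IsSubcomodule.map {ρ : E →ₗ[K] A ⊗[K] E} {ρ' : F →ₗ[K] A ⊗[K] F} {π : E →ₗ[K] F}
    (hπ : ∀ m, ρ' (π m) = π.lTensor A (ρ m)) {W : Submodule K E} (hW : IsSubcomodule ρ W) :
    IsSubcomodule ρ' (W.map π) := by
  rintro _ ⟨w, hw, rfl⟩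
  obtain ⟨t, ht⟩ := hW w hw
  refine ⟨(π.submoduleMap W).lTensor A t, ?_⟩
  rw [hπ, ← ht, ← LinearMap.lTensor_comp_apply, ← LinearMap.lTensor_comp_apply]
  rfl

omit [Coalgebra K A] in
theorem mem_range_lTensor_subtype {W : Submodule K E} {a : A} {w : E} (hw : w ∈ W) :
    a ⊗ₜ[K] w ∈ LinearMap.range (W.subtype.lTensor A) :=
  ⟨a ⊗ₜ ⟨w, hw⟩, by simp⟩

omit [Coalgebra K A] in
theorem range_lTensor_induction {W : Submodule K E} {P : A ⊗[K] E → Prop} {t : A ⊗[K] E}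
    (ht : t ∈ LinearMap.range (W.subtype.lTensor A)) (htmul : ∀ (a : A), ∀ w ∈ W, P (a ⊗ₜ w))
    (hadd : ∀ s t, P s → P t → P (s + t)) : P t := by
  obtain ⟨t, rfl⟩ := ht
  induction t with
  | zero => simpa using htmul 0 0 (zero_mem _)
  | add s t hs ht => rw [map_add]; exact hadd _ _ hs ht
  | tmul a w => exact htmul a w w.2

/-- Every element of a comodule lies in a finite-dimensional subcomodule. -/
theorem IsHopfModule.exists_subcomodule {hB : IsLeftCoidealSupersubalgebra 𝒜 B}
    {R : B →ₗ[K] Module.End K E} {ρ : E →ₗ[K] A ⊗[K] E} (h : IsHopfModule hB R ρ) (m : E) :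
    ∃ W : Submodule K E, W.FG ∧ IsSubcomodule ρ W ∧ m ∈ W := by
  classical
  let e := Module.Basis.ofVectorSpace K A
  let c := TensorProduct.equivFinsuppOfBasisLeft e (ρ m)
  have hc : ρ m = c.sum fun i x => e i ⊗ₜ x := by
    rw [← TensorProduct.equivFinsuppOfBasisLeft_symm_apply, LinearEquiv.symm_apply_apply]
  have hc' : ∀ i, c i = TensorProduct.lid K E ((e.coord i).rTensor E (ρ m)) :=
    TensorProduct.equivFinsuppOfBasisLeft_apply e (ρ m)
  -- `W` is spanned by the coefficients of `ρ m` in a basis of `A`. Coassociativity makes it a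
  -- subcomodule, and the counit recovers `m` from these coefficients.
  let W := Submodule.span K (c '' (c.support : Set _))
  have hcW : ∀ i, c i ∈ W := by
    intro i
    by_cases hi : i ∈ c.support
    · exact Submodule.subset_span ⟨i, hi, rfl⟩
    · rw [Finsupp.notMem_support_iff.1 hi]
      exact zero_mem _
  have hm : ρ m ∈ LinearMap.range (W.subtype.lTensor A) := by
    rw [hc]
    exact Submodule.sum_mem _ fun i _ => mem_range_lTensor_subtype (hcW i)
  refine ⟨W, Submodule.fg_span (c.support.finite_toSet.image c), ?_, ?_⟩
  · have hcomod : ∀ i, ρ (c i) ∈ LinearMap.range (W.subtype.lTensor A) := by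
      intro i
      have h1 : ∀ t : A ⊗[K] E, ρ (TensorProduct.lid K E ((e.coord i).rTensor E t)) =
          TensorProduct.lid K _ ((e.coord i).rTensor _ (ρ.lTensor A t)) := by
        intro t
        induction t with
        | zero => simp
        | add s t hs ht => simp only [map_add, hs, ht]
        | tmul a x => simp
      rw [hc', h1, h.coassoc]
      refine range_lTensor_induction (P := fun t => TensorProduct.lid K _ ((e.coord i).rTensor _
        (TensorProduct.assoc K A A E ((superComul 𝒜).rTensor E t))) ∈
          LinearMap.range (W.subtype.lTensor A)) hm ?_ ?_
      · intro a w hw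
        rw [LinearMap.rTensor_tmul]
        induction superComul 𝒜 a with
        | zero => simp
        | add s t hs ht => simp only [TensorProduct.add_tmul, map_add]; exact add_mem hs ht
        | tmul x y =>
          simp only [TensorProduct.assoc_tmul, LinearMap.rTensor_tmul, TensorProduct.lid_tmul]
          exact Submodule.smul_mem _ _ (mem_range_lTensor_subtype hw)
      · intro s t hs ht
        simp only [map_add]
        exact add_mem hs ht
    intro w hw
    induction hw using Submodule.span_induction with
    | mem x hx => obtain ⟨i, -, rfl⟩ := hx; exact hcomod i
    | zero => simp
    | add x y _ _ hx hy => rw [map_add]; exact add_mem hx hy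
    | smul c x _ hx => rw [map_smul]; exact Submodule.smul_mem _ _ hx
  · rw [← h.counit m]
    refine range_lTensor_induction (P := fun t =>
      TensorProduct.lid K _ ((Coalgebra.counit (R := K)).rTensor _ t) ∈ W) hm ?_ ?_
    · intro a w hw
      simpa using W.smul_mem _ hw
    · intro s t hs ht
      simp only [map_add]
      exact add_mem hs ht

end HopfModule

/-! ### Local freeness and exactness of the fibre at the counit -/

section FibreExactness

variable {K : Type*} [Field K] {A : Type*} [Ring A] [Algebra K A]
  {𝒜 : ZMod 2 → Submodule K A} [GradedAlgebra 𝒜] [Coalgebra K A] {B : Subalgebra K A}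
  {E : Type*} [AddCommGroup E] [Module K E] {F : Type*} [AddCommGroup F] [Module K F]

/-- The subspace `X B⁺` spanned by the `x b`, where `x ∈ X` and `b ∈ B` is killed by the counit. -/
def augmentationSpan (R : B →ₗ[K] Module.End K E) (X : Submodule K E) : Submodule K E :=
  Submodule.span K
    {t | ∃ (b : B) (x : E), Coalgebra.counit (R := K) (b : A) = 0 ∧ x ∈ X ∧ t = R b x}

theorem apply_mem_augmentationSpan (R : B →ₗ[K] Module.End K E) {X : Submodule K E} {b : B} {x : E}
    (hb : Coalgebra.counit (R := K) (b : A) = 0) (hx : x ∈ X) : R b x ∈ augmentationSpan R X :=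
  Submodule.subset_span ⟨b, x, hb, hx, rfl⟩

theorem augmentationSpan_mono (R : B →ₗ[K] Module.End K E) {X Y : Submodule K E} (h : X ≤ Y) :
    augmentationSpan R X ≤ augmentationSpan R Y :=
  Submodule.span_mono fun _ ⟨b, x, hb, hx, ht⟩ => ⟨b, x, hb, h hx, ht⟩

theorem augmentationSpan_induction {R : B →ₗ[K] Module.End K E} {X : Submodule K E} {P : E → Prop}
    {t : E} (ht : t ∈ augmentationSpan R X) (zero : P 0)
    (act : ∀ (b : B), ∀ x ∈ X, Coalgebra.counit (R := K) (b : A) = 0 → P (R b x))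
    (add : ∀ s t, P s → P t → P (s + t)) : P t := by
  have : ∀ t ∈ augmentationSpan R X, P t ∧ ∀ c : K, P (c • t) := by
    intro t ht
    induction ht using Submodule.span_induction with
    | mem t ht =>
      obtain ⟨b, x, hb, hx, rfl⟩ := ht
      refine ⟨act b x hx hb, fun c => ?_⟩
      rw [← LinearMap.map_smul]
      exact act b _ (X.smul_mem c hx) hb
    | zero => simpa using zero
    | add s t _ _ hs ht =>
      exact ⟨add _ _ hs.1 ht.1, fun c => smul_add c s t ▸ add _ _ (hs.2 c) (ht.2 c)⟩
    | smul c t _ ht => exact ⟨ht.2 c, fun c' => smul_smul c' c t ▸ ht.2 _⟩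
  exact (this t ht).1

theorem exists_eq_sum_of_mem_augmentationSpan {R : B →ₗ[K] Module.End K E} {ι : Type*} [Fintype ι]
    {w : ι → E} {t : E} (ht : t ∈ augmentationSpan R (Submodule.span K (Set.range w))) :
    ∃ c : ι → B, (∀ i, Coalgebra.counit (R := K) (c i : A) = 0) ∧ t = ∑ i, R (c i) (w i) := by
  refine augmentationSpan_induction (P := fun t => ∃ c : ι → B,
    (∀ i, Coalgebra.counit (R := K) (c i : A) = 0) ∧ t = ∑ i, R (c i) (w i)) ht
    ⟨0, by simp⟩ ?_ ?_
  · intro b x hx hb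
    obtain ⟨a, rfl⟩ := (Submodule.mem_span_range_iff_exists_fun K).1 hx
    exact ⟨fun i => a i • b, fun i => by simp [hb], by simp⟩
  · rintro _ _ ⟨c, hc, rfl⟩ ⟨c', hc', rfl⟩
    exact ⟨c + c', fun i => by simp [hc, hc'], by simp [Finset.sum_add_distrib]⟩

theorem IsHopfModule.exists_subcomodule_mem_augmentationSpan
    {hB : IsLeftCoidealSupersubalgebra 𝒜 B} {R : B →ₗ[K] Module.End K E}
    {ρ : E →ₗ[K] A ⊗[K] E} (h : IsHopfModule hB R ρ) {t : E} (ht : t ∈ augmentationSpan R ⊤) :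
    ∃ W : Submodule K E, W.FG ∧ IsSubcomodule ρ W ∧ t ∈ augmentationSpan R W := by
  refine augmentationSpan_induction (P := fun t => ∃ W : Submodule K E, W.FG ∧ IsSubcomodule ρ W ∧
    t ∈ augmentationSpan R W) ht ⟨⊥, Submodule.fg_bot, ?_, zero_mem _⟩ ?_ ?_
  · intro w hw
    rw [(Submodule.mem_bot K).1 hw, map_zero]
    exact zero_mem _
  · intro b x _ hb
    obtain ⟨W, hW, hWρ, hx⟩ := h.exists_subcomodule x
    exact ⟨W, hW, hWρ, apply_mem_augmentationSpan R hb hx⟩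
  · rintro s t ⟨V, hV, hVρ, hs⟩ ⟨W, hW, hWρ, ht⟩
    exact ⟨V ⊔ W, hV.sup hW, hVρ.sup hWρ, add_mem (augmentationSpan_mono R le_sup_left hs)
      (augmentationSpan_mono R le_sup_right ht)⟩

/-- A basis of the image of `W` in `F / N` is lifted to `W`, and its coordinate functionals are
extended to all of `F / N`. With `N = W B⁺` this gives lifts of a basis of the fibre and functionals
vanishing on `W B⁺`. -/
theorem exists_coordinates (W N : Submodule K F) (hW : W.FG) :
    ∃ (n : ℕ) (u : Fin n → F) (z : Fin n → F →ₗ[K] K), (∀ i, u i ∈ W) ∧ (∀ i, ∀ x ∈ N, z i x = 0) ∧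
      (∀ i j, z i (u j) = if i = j then 1 else 0) ∧ ∀ x ∈ W, x - ∑ i, z i x • u i ∈ N := by
  have hV : (W.map N.mkQ).FG := hW.map _
  have : Module.Finite K (W.map N.mkQ) := Module.Finite.iff_fg.2 hV
  let v := Module.finBasis K (W.map N.mkQ)
  obtain ⟨l, hl⟩ := LinearMap.exists_extend (v.equivFun.toLinearMap)
  choose u hu huv using fun i => (v i).2
  have hz : ∀ x (hx : x ∈ W), l (N.mkQ x) = v.equivFun ⟨N.mkQ x, Submodule.mem_map_of_mem hx⟩ :=
    fun x hx => LinearMap.congr_fun hl ⟨N.mkQ x, Submodule.mem_map_of_mem hx⟩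
  refine ⟨_, u, fun i => LinearMap.proj i ∘ₗ l ∘ₗ N.mkQ, hu, ?_, ?_, ?_⟩
  · intro i x hx
    have : N.mkQ x = 0 := (Submodule.Quotient.mk_eq_zero N).2 hx
    rw [LinearMap.comp_apply, LinearMap.comp_apply, this, map_zero, map_zero]
  · intro i j
    have h1 : (⟨N.mkQ (u j), Submodule.mem_map_of_mem (hu j)⟩ : W.map N.mkQ) = v j :=
      Subtype.ext (huv j)
    rw [LinearMap.comp_apply, LinearMap.comp_apply, hz _ (hu j), h1]
    simp [Finsupp.single_apply, eq_comm]
  · intro x hx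
    rw [← Submodule.Quotient.mk_eq_zero, ← Submodule.mkQ_apply, map_sub, map_sum, sub_eq_zero]
    have h1 := congrArg Subtype.val
      (v.sum_equivFun ⟨N.mkQ x, Submodule.mem_map_of_mem hx⟩)
    refine h1.symm.trans ?_
    rw [AddSubmonoidClass.coe_finsetSum]
    refine Finset.sum_congr rfl fun i _ => ?_
    rw [LinearMap.map_smul, LinearMap.comp_apply, LinearMap.comp_apply, hz x hx, SetLike.val_smul,
      ← huv]
    rfl

variable [HopfSuperalgebra 𝒜]

/-- Nakayama's lemma: lifts of generators of the fibre at the counit generate, locally. -/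
theorem exists_local_generators (hA : IsSuperCommutative 𝒜) (hK : (2 : K) ≠ 0)
    (hB : IsLeftCoidealSupersubalgebra 𝒜 B) {R : B →ₗ[K] Module.End K F}
    (hmul : ∀ b c, R (b * c) = R c * R b) {W : Submodule K F} (hW : W.FG) {n : ℕ}
    {u : Fin n → F} {z : Fin n → F →ₗ[K] K}
    (hz : ∀ x ∈ W, x - ∑ i, z i x • u i ∈ augmentationSpan R W) :
    ∃ s : B, (s : A) ∈ 𝒜 0 ∧ Coalgebra.counit (R := K) (s : A) = 1 ∧
      ∀ x ∈ W, ∃ d : Fin n → B, R s x = ∑ i, R (d i) (u i) := by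
  obtain ⟨r, w, rfl⟩ := Submodule.fg_iff_exists_fin_generating_family.1 hW
  have hw : ∀ k, w k ∈ Submodule.span K (Set.range w) := fun k => Submodule.subset_span ⟨k, rfl⟩
  choose c hc hcw using fun k => exists_eq_sum_of_mem_augmentationSpan (hz (w k) (hw k))
  -- The indices are transposed because `B` acts on the right: `w m` acted on by `s` is the sum over
  -- `l` of `w l` acted on by the `(l, m)` entry of `(1 - C) * Q`.
  obtain ⟨Q, s, hs, hs1, hQ⟩ := hB.exists_one_sub_mul_eq_scalar hA hK (Matrix.of fun l k => c k l)
    (fun l k => hc k l)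
  refine ⟨s, hs, hs1, ?_⟩
  have hgen : ∀ m, R s (w m) = ∑ i, R (∑ k, z i (w k) • Q k m) (u i) := by
    intro m
    have h1 : ∀ l, (if l = m then s else 0) = Q l m - ∑ k, c k l * Q k m := by
      intro l
      have := congrFun (congrFun hQ l) m
      rw [sub_mul, one_mul, Matrix.sub_apply, Matrix.mul_apply, Matrix.scalar_apply,
        Matrix.diagonal_apply] at this
      exact this.symm
    calc R s (w m) = ∑ l, R (if l = m then s else 0) (w l) := by
          rw [Finset.sum_eq_single m (fun l _ hl => by simp [hl]) (by simp), if_pos rfl]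
      _ = ∑ l, R (Q l m) (w l) - ∑ k, R (Q k m) (∑ l, R (c k l) (w l)) := by
          simp only [h1, map_sub, LinearMap.sub_apply, map_sum, LinearMap.sum_apply,
            Finset.sum_sub_distrib, hmul, Module.End.mul_apply]
          rw [Finset.sum_comm]
      _ = ∑ k, R (Q k m) (∑ i, z i (w k) • u i) := by
          rw [← Finset.sum_sub_distrib]
          refine Finset.sum_congr rfl fun k _ => ?_
          rw [← hcw, map_sub, sub_sub_cancel]
      _ = _ := by
          simp only [map_sum, map_smul, LinearMap.sum_apply, LinearMap.smul_apply]
          rw [Finset.sum_comm]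
  intro x hx
  obtain ⟨a, rfl⟩ := (Submodule.mem_span_range_iff_exists_fun K).1 hx
  refine ⟨fun i => ∑ m, a m • ∑ k, z i (w k) • Q k m, ?_⟩
  rw [map_sum]
  simp_rw [map_smul, hgen, Finset.smul_sum, map_sum, LinearMap.sum_apply]
  rw [Finset.sum_comm]
  refine Finset.sum_congr rfl fun i _ => Finset.sum_congr rfl fun m _ => ?_
  simp [Finset.smul_sum]

variable (ρ : F →ₗ[K] A ⊗[K] F)

/-- The coefficient map `m ↦ ∑ m₋₁ z(m₀)` of a functional `z`. -/
noncomputable def coefficientMap (z : F →ₗ[K] K) : F →ₗ[K] A :=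
  (TensorProduct.rid K A).toLinearMap ∘ₗ z.lTensor A ∘ₗ ρ

variable {ρ}

/-- Since `z` kills `W B⁺`, it satisfies `z(y b) = ε(b) z(y)` on `W`. As `ρ x` lies in `A ⊗ W`,
compatibility then collapses the diagonal action to right multiplication in `A`. -/
theorem coefficientMap_apply_action (hA : IsSuperCommutative 𝒜)
    {hB : IsLeftCoidealSupersubalgebra 𝒜 B} {R : B →ₗ[K] Module.End K F}
    (h : IsHopfModule hB R ρ) {W : Submodule K F} (hW : IsSubcomodule ρ W)
    {z : F →ₗ[K] K} (hz : ∀ x ∈ augmentationSpan R W, z x = 0) (b : B) {x : F} (hx : x ∈ W) :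
    coefficientMap ρ z (R b x) = coefficientMap ρ z x * b := by
  have hzR : ∀ y ∈ W, ∀ c : B, z (R c y) = Coalgebra.counit (R := K) (c : A) • z y := by
    intro y hy c
    have h1 := hz _ (apply_mem_augmentationSpan R
      (b := c - algebraMap K B (Coalgebra.counit (R := K) (c : A))) (x := y) (X := W) (by
        simp [Algebra.algebraMap_eq_smul_one, HopfSuperalgebra.counit_one (𝒜 := 𝒜)]) hy)
    rw [Algebra.algebraMap_eq_smul_one, map_sub, map_smul, h.map_one, LinearMap.sub_apply, map_sub,
      sub_eq_zero] at h1
    simpa using h1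
  simp only [coefficientMap, LinearMap.comp_apply, h.compat, LinearEquiv.coe_coe]
  refine range_lTensor_induction (P := fun t => TensorProduct.rid K A
    (z.lTensor A (hB.diagonalAction R b t)) = TensorProduct.rid K A (z.lTensor A t) * b)
      (hW x hx) ?_ ?_
  · intro a y hy
    rw [hB.lTensor_diagonalAction_of_counit R hA z (hzR y hy)]
    simp
  · intro s t hs ht
    simp only [map_add, hs, ht, add_mul]

/-- By coassociativity and the antipode identity, `z(x)` is recovered from coefficients as `∑ κ(x₀)
S(x₋₁)`, with `κ` the coefficient map of `z`. This supplies the right inverse of the coefficient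
matrix. -/
theorem mul_antipode_coefficientMap (hA : IsSuperCommutative 𝒜)
    {hB : IsLeftCoidealSupersubalgebra 𝒜 B} {R : B →ₗ[K] Module.End K F}
    (h : IsHopfModule hB R ρ) (z : F →ₗ[K] K) (x : F) :
    LinearMap.mul' K A (TensorProduct.comm K A A (TensorProduct.map
      (HopfSuperalgebra.antipode 𝒜) (coefficientMap ρ z) (ρ x))) = algebraMap K A (z x) := by
  have h1 : ∀ t : A ⊗[K] F, TensorProduct.map (HopfSuperalgebra.antipode 𝒜) (coefficientMap ρ z) t =
      (HopfSuperalgebra.antipode 𝒜).rTensor A (((TensorProduct.rid K A).toLinearMap ∘ₗ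
        z.lTensor A).lTensor A (ρ.lTensor A t)) := by
    intro t
    induction t with
    | zero => simp
    | add s t hs ht => simp only [map_add, hs, ht]
    | tmul a y => simp [coefficientMap]
  rw [h1, h.coassoc]
  conv_rhs => rw [← h.counit x]
  induction ρ x with
  | zero => simp
  | add s t hs ht => simp only [map_add, hs, ht]
  | tmul a y =>
    have h2 : ∀ t : A ⊗[K] A, LinearMap.mul' K A (TensorProduct.comm K A A
        ((HopfSuperalgebra.antipode 𝒜).rTensor A (((TensorProduct.rid K A).toLinearMap ∘ₗ
        z.lTensor A).lTensor A (TensorProduct.assoc K A A F (t ⊗ₜ y))))) =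
        z y • LinearMap.mul' K A (TensorProduct.comm K A A
          ((HopfSuperalgebra.antipode 𝒜).rTensor A t)) := by
      intro t
      induction t with
      | zero => simp
      | add s t hs ht => simp only [map_add, TensorProduct.add_tmul, smul_add, hs, ht]
      | tmul a a' => simp
    rw [LinearMap.rTensor_tmul, h2, mul_comm_antipode_superComul hA]
    simp [Algebra.algebraMap_eq_smul_one, smul_smul, mul_comm]

/-- Relations between the lifts of a basis of the fibre at the counit are locally trivial. -/
theorem exists_pow_mul_eq_zero (hA : IsSuperCommutative 𝒜) (hK : (2 : K) ≠ 0)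
    {hB : IsLeftCoidealSupersubalgebra 𝒜 B} {R : B →ₗ[K] Module.End K F}
    (h : IsHopfModule hB R ρ) {W : Submodule K F} (hW : IsSubcomodule ρ W) {n : ℕ}
    {u : Fin n → F} {z : Fin n → F →ₗ[K] K} (hu : ∀ i, u i ∈ W)
    (hz : ∀ i, ∀ x ∈ augmentationSpan R W, z i x = 0)
    (hzu : ∀ i j, z i (u j) = if i = j then 1 else 0) {s : B} (hs : (s : A) ∈ 𝒜 0)
    (hgen : ∀ x ∈ W, ∃ d : Fin n → B, R s x = ∑ i, R (d i) (u i)) :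
    ∃ k : ℕ, ∀ e : Fin n → B, ∑ j, R (e j) (u j) = 0 → ∀ j, s ^ k * e j = 0 := by
  let P : Matrix (Fin n) (Fin n) A := Matrix.of fun i j => coefficientMap ρ (z i) (u j)
  have hκ : ∀ i b x, x ∈ W → coefficientMap ρ (z i) (R b x) = coefficientMap ρ (z i) x * b :=
    fun i b x hx => coefficientMap_apply_action hA h hW (hz i) b hx
  -- Multiplying by `s` replaces `x` by a combination of the `u i`, and `B`-linearity of the
  -- coefficient maps extracts the entries of `P`. The vector `q` does not depend on `k`, so the
  -- solutions for `t = ρ (u j)` form the columns of a matrix.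
  have hsol : ∀ t ∈ LinearMap.range (W.subtype.lTensor A), ∃ q : Fin n → A, ∀ k,
      LinearMap.mul' K A (TensorProduct.comm K A A (TensorProduct.map
        (HopfSuperalgebra.antipode 𝒜) (coefficientMap ρ (z k)) t)) * s = ∑ i, P k i * q i := by
    intro t ht
    refine range_lTensor_induction (P := fun t => ∃ q : Fin n → A, ∀ k,
      LinearMap.mul' K A (TensorProduct.comm K A A (TensorProduct.map
        (HopfSuperalgebra.antipode 𝒜) (coefficientMap ρ (z k)) t)) * s = ∑ i, P k i * q i) ht ?_ ?_
    · intro a x hx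
      obtain ⟨d, hd⟩ := hgen x hx
      refine ⟨fun i => d i * HopfSuperalgebra.antipode 𝒜 a, fun k => ?_⟩
      rw [TensorProduct.map_tmul, TensorProduct.comm_tmul, LinearMap.mul'_apply, mul_assoc,
        ← hA.even_mul hs, ← mul_assoc, ← hκ k s x hx, hd, map_sum, Finset.sum_mul]
      exact Finset.sum_congr rfl fun i _ => by rw [hκ k _ _ (hu i), mul_assoc]; rfl
    · rintro t t' ⟨q, hq⟩ ⟨q', hq'⟩
      exact ⟨q + q', fun k => by
        simp only [map_add, add_mul, hq, hq', Pi.add_apply, mul_add, Finset.sum_add_distrib]⟩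
  choose q hq using fun j => hsol _ (hW (u j) (hu j))
  have hPQ : P * Matrix.of (fun i j => q j i) = Matrix.scalar (Fin n) (s : A) := by
    ext k j
    rw [Matrix.mul_apply, Matrix.scalar_apply, Matrix.diagonal_apply]
    refine (hq j k).symm.trans ?_
    rw [mul_antipode_coefficientMap hA h, hzu]
    split_ifs <;> simp
  obtain ⟨X, k, hX⟩ := hA.exists_mul_eq_scalar hK hs hPQ
  refine ⟨k, fun e he j => ?_⟩
  -- The coefficient maps send a relation among the `u j` to a vector in the kernel of `P`, where
  -- left invertibility applies.
  have h1 : P.mulVec (fun j => (e j : A)) = 0 := by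
    ext i
    rw [Matrix.mulVec, dotProduct, Pi.zero_apply, ← map_zero (coefficientMap ρ (z i)), ← he,
      map_sum]
    exact Finset.sum_congr rfl fun j _ => (hκ i _ _ (hu j)).symm
  have h2 : (X * P).mulVec (fun j => (e j : A)) = 0 := by
    rw [← Matrix.mulVec_mulVec, h1, Matrix.mulVec_zero]
  rw [hX] at h2
  have h3 := congrFun h2 j
  refine Subtype.ext ?_
  simpa [Matrix.scalar_apply, Matrix.mulVec_diagonal] using h3

/-- Passing to the fibre at the counit is exact on Hopf modules. -/
theorem IsHopfModule.mem_augmentationSpan_ker (hA : IsSuperCommutative 𝒜) (hK : (2 : K) ≠ 0)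
    {hB : IsLeftCoidealSupersubalgebra 𝒜 B} {R : B →ₗ[K] Module.End K E} {ρ : E →ₗ[K] A ⊗[K] E}
    (h : IsHopfModule hB R ρ) {R' : B →ₗ[K] Module.End K F} {ρ' : F →ₗ[K] A ⊗[K] F}
    (h' : IsHopfModule hB R' ρ') {π : E →ₗ[K] F} (hR : ∀ b m, π (R b m) = R' b (π m))
    (hρ : ∀ m, ρ' (π m) = π.lTensor A (ρ m)) {t : E} (ht : t ∈ augmentationSpan R ⊤)
    (hπ : π t = 0) : t ∈ augmentationSpan R (LinearMap.ker π) := by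
  obtain ⟨W, hWfg, hW, htW⟩ := h.exists_subcomodule_mem_augmentationSpan ht
  obtain ⟨n, u', z, hu', hz, hzu, hWz⟩ :=
    exists_coordinates (W.map π) (augmentationSpan R' (W.map π)) (hWfg.map π)
  choose u hu huu using hu'
  obtain ⟨s, hs, hs1, hgen⟩ := exists_local_generators hA hK hB h'.map_mul (hWfg.map π) hWz
  obtain ⟨k, hk⟩ := exists_pow_mul_eq_zero hA hK h' (hW.map hρ)
    (fun i => huu i ▸ Submodule.mem_map_of_mem (hu i)) hz hzu hs hgen
  have hsc : ∀ b : B, s * b = b * s := fun b => Subtype.ext (hA.even_mul hs b)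
  -- For a generator `x b` with `ε(b) = 0`, the difference of `x s` and `∑ uᵢ dᵢ` lies in `ker π`;
  -- multiplying by `b`, which commutes with `s`, puts the error in `(ker π) B⁺`.
  have hlift : ∃ (e : Fin n → B), ∃ y ∈ augmentationSpan R (LinearMap.ker π),
      R s t = ∑ i, R (e i) (u i) + y := by
    refine augmentationSpan_induction (P := fun t => ∃ (e : Fin n → B),
      ∃ y ∈ augmentationSpan R (LinearMap.ker π), R s t = ∑ i, R (e i) (u i) + y) htW
      ⟨0, 0, zero_mem _, by simp⟩ ?_ ?_
    · intro b x hx hb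
      obtain ⟨d, hd⟩ := hgen (π x) (Submodule.mem_map_of_mem hx)
      refine ⟨fun i => d i * b, R b (R s x - ∑ i, R (d i) (u i)),
        apply_mem_augmentationSpan R hb ?_, ?_⟩
      · rw [LinearMap.mem_ker, map_sub, hR, hd, map_sum, sub_eq_zero]
        exact Finset.sum_congr rfl fun i _ => by rw [hR, huu]
      · rw [map_sub, map_sum]
        simp only [h.map_mul, Module.End.mul_apply]
        rw [add_sub_cancel, ← Module.End.mul_apply, ← Module.End.mul_apply, ← h.map_mul,
          ← h.map_mul, hsc]
    · rintro t t' ⟨e, y, hy, hty⟩ ⟨e', y', hy', hty'⟩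
      refine ⟨e + e', y + y', add_mem hy hy', ?_⟩
      rw [map_add, hty, hty']
      simp only [Pi.add_apply, map_add, LinearMap.add_apply, Finset.sum_add_distrib]
      abel
  obtain ⟨e, y, hy, hty⟩ := hlift
  have hπy : π y = 0 := by
    refine augmentationSpan_induction (P := fun y => π y = 0) hy (map_zero _) ?_ ?_
    · intro b x hx _
      rw [hR, LinearMap.mem_ker.1 hx, map_zero]
    · intro x y hx hy
      rw [map_add, hx, hy, add_zero]
  -- Applying `π` removes both `t` and the error, leaving a relation among the `u' j`, so `s ^ k`
  -- kills every `e j`.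
  have hrel : ∑ j, R' (e j) (u' j) = 0 := by
    have h1 := congrArg π hty
    rw [hR, hπ, map_zero, map_add, hπy, add_zero, map_sum] at h1
    rw [h1]
    exact Finset.sum_congr rfl fun j _ => by rw [hR, huu]
  have hcomm : ∀ b : B, s ^ k * b = b * s ^ k := fun b =>
    ((show Commute s b from hsc b).pow_left k).eq
  have h1 : R (s ^ (k + 1)) t = R (s ^ k) y := by
    rw [pow_succ', h.map_mul, Module.End.mul_apply, hty, map_add, map_sum, add_eq_right]
    refine Finset.sum_eq_zero fun j _ => ?_
    rw [← Module.End.mul_apply, ← h.map_mul, ← hcomm, hk e hrel, map_zero, LinearMap.zero_apply]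
  have h2 : R (s ^ k) y ∈ augmentationSpan R (LinearMap.ker π) := by
    refine augmentationSpan_induction (P := fun y => R (s ^ k) y ∈
      augmentationSpan R (LinearMap.ker π)) hy (by simp) ?_ ?_
    · intro b x hx hb
      rw [← Module.End.mul_apply, ← h.map_mul]
      refine apply_mem_augmentationSpan R ?_ hx
      rw [Subalgebra.coe_mul, HopfSuperalgebra.counit_mul (𝒜 := 𝒜), hb, zero_mul]
    · intro x y hx hy
      rw [map_add]
      exact add_mem hx hy
  -- The first summand equals `y s ^ k`. The second lies in `(ker π) B⁺` because `t ∈ ker π` and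
  -- `ε(1 - s ^ (k + 1)) = 0`.
  have h3 : t = R (s ^ (k + 1)) t + R (1 - s ^ (k + 1)) t := by
    rw [map_sub, h.map_one, LinearMap.sub_apply, Module.End.one_apply, add_sub_cancel]
  rw [h3, h1]
  refine add_mem h2 (apply_mem_augmentationSpan R ?_ hπ)
  rw [← counitAlgHom_apply (𝒜 := 𝒜)]
  simp [-counitAlgHom_apply, map_sub, map_pow]
  simp [hs1]

end FibreExactness

/-! ### The fibre functor on `B`-modules -/

section Fibre

variable {K : Type*} [Field K] {A : Type*} [Ring A] [Algebra K A]
  {𝒜 : ZMod 2 → Submodule K A} [GradedAlgebra 𝒜] [Coalgebra K A] [HopfSuperalgebra 𝒜]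
  {B : Subalgebra K A}
  {X : Type*} [AddCommGroup X] [Module K X] {Y : Type*} [AddCommGroup Y] [Module K Y]
  {Z : Type*} [AddCommGroup Z] [Module K Z]

/-- The functor `Y ↦ (A ⊗ Y) / (A ⊗ Y) B⁺` is exact. -/
theorem IsLeftCoidealSupersubalgebra.exact_fibre (hA : IsSuperCommutative 𝒜) (hK : (2 : K) ≠ 0)
    (hB : IsLeftCoidealSupersubalgebra 𝒜 B) {r : B →ₗ[K] Module.End K Y}
    {r' : B →ₗ[K] Module.End K Z} (h1' : r' 1 = 1)
    (hmul' : ∀ b c, r' (b * c) = r' c * r' b) {f : X →ₗ[K] Y} {g : Y →ₗ[K] Z}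
    (hfg : Function.Exact f g) (hg : ∀ b y, g (r b y) = r' b (g y)) {t : A ⊗[K] Y}
    (ht : g.lTensor A t ∈ augmentationSpan (hB.diagonalAction r') ⊤) :
    ∃ x, ∃ t' ∈ augmentationSpan (hB.diagonalAction r) ⊤, t = f.lTensor A x + t' := by
  have hstab : ∀ b, LinearMap.range g ≤ (LinearMap.range g).comap (r' b) := by
    rintro b _ ⟨y, rfl⟩
    exact ⟨r b y, hg b y⟩
  -- The image of `g` is realised as the kernel of the projection to its cokernel, so that the Hopf
  -- module lemma gives `g(t) ∈ (A ⊗ im g) B⁺`. Such an element lifts to `(A ⊗ Y) B⁺`, and the lift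
  -- differs from `t` by an element of `A ⊗ im f`.
  let q : B →ₗ[K] Module.End K (Z ⧸ LinearMap.range g) :=
    { toFun := fun b => (LinearMap.range g).mapQ (LinearMap.range g) (r' b) (hstab b)
      map_add' := fun b c => by ext; simp
      map_smul' := fun b c => by ext; simp }
  have hq1 : q 1 = 1 := by ext; simp [q, h1']
  have hqmul : ∀ b c, q (b * c) = q c * q b := fun b c => by ext; simp [q, hmul']
  have hqπ : ∀ b z, (LinearMap.range g).mkQ (r' b z) = q b ((LinearMap.range g).mkQ z) :=
    fun b z => by simp [q]
  have hexact : Function.Exact (g.lTensor A) ((LinearMap.range g).mkQ.lTensor A) :=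
    Module.Flat.lTensor_exact A (LinearMap.exact_map_mkQ_range g)
  have hker := (isHopfModule_diagonalAction hA hB h1' hmul').mem_augmentationSpan_ker hA hK
    (isHopfModule_diagonalAction hA hB hq1 hqmul) (hB.lTensor_diagonalAction hqπ)
    (fun m => (lTensor_freeCoaction _ m).symm) ht ((hexact _).2 ⟨t, rfl⟩)
  obtain ⟨t', ht', htt'⟩ : ∃ t' ∈ augmentationSpan (hB.diagonalAction r) ⊤,
      g.lTensor A t' = g.lTensor A t := by
    refine augmentationSpan_induction (P := fun s => ∃ t' ∈
      augmentationSpan (hB.diagonalAction r) ⊤, g.lTensor A t' = s) hker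
      ⟨0, zero_mem _, map_zero _⟩ ?_ ?_
    · intro b x hx hb
      obtain ⟨y, rfl⟩ := (hexact x).1 hx
      exact ⟨_, apply_mem_augmentationSpan _ hb (Submodule.mem_top (x := y)),
        hB.lTensor_diagonalAction hg b y⟩
    · rintro _ _ ⟨s, hs, rfl⟩ ⟨s', hs', rfl⟩
      exact ⟨s + s', add_mem hs hs', map_add _ _ _⟩
  obtain ⟨x, hx⟩ := (Module.Flat.lTensor_exact A hfg (t - t')).1 (by
    rw [map_sub, htt', sub_self])
  exact ⟨x, t', ht', by rw [hx, sub_add_cancel]⟩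

theorem IsLeftCoidealSupersubalgebra.rTensor_counit_coaction
    (hB : IsLeftCoidealSupersubalgebra 𝒜 B) (b : B) :
    TensorProduct.lid K B ((Coalgebra.counit (R := K)).rTensor B (hB.coaction b)) = b := by
  have h1 : ∀ t : A ⊗[K] B,
      ((TensorProduct.lid K B ((Coalgebra.counit (R := K)).rTensor B t) : B) : A) =
      TensorProduct.lid K A
        ((Coalgebra.counit (R := K)).rTensor A (B.val.toLinearMap.lTensor A t)) := by
    intro t
    induction t with
    | zero => simp
    | add s t hs ht => simp only [map_add, Subalgebra.coe_add, hs, ht]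
    | tmul x c => simp
  refine Subtype.ext ?_
  rw [h1, hB.lTensor_coaction, rTensor_counit_superComul]
  simp

theorem counit_proj_one (hB : IsLeftCoidealSupersubalgebra 𝒜 B) (b : B) :
    Coalgebra.counit (R := K) (hB.proj 1 b : A) = 0 :=
  HopfSuperalgebra.counit_odd _ (proj_mem 1 (b : A))

theorem counit_proj_zero (hB : IsLeftCoidealSupersubalgebra 𝒜 B) (b : B) :
    Coalgebra.counit (R := K) (hB.proj 0 b : A) = Coalgebra.counit (R := K) (b : A) := by
  conv_rhs => rw [← hB.proj_zero_add_proj_one b, Subalgebra.coe_add, map_add, counit_proj_one,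
    add_zero]

/-- The even part contributes the action of `b₀ - ε(b)` and the odd part that of an element killed
by the counit, so both lie in the augmentation span. -/
theorem mulTensorAction_sub_mem_augmentationSpan (hB : IsLeftCoidealSupersubalgebra 𝒜 B)
    {r : B →ₗ[K] Module.End K Y} (h1 : r 1 = 1) (b : B) (m : A ⊗[K] Y) :
    mulTensorAction r (hB.coaction b) m - Coalgebra.counit (R := K) (b : A) • m ∈
      augmentationSpan (hB.diagonalAction r) ⊤ := by
  have h2 : hB.diagonalAction r (hB.proj 0 b) m - Coalgebra.counit (R := K) (b : A) • m =
      hB.diagonalAction r (hB.proj 0 b - Coalgebra.counit (R := K) (b : A) • 1) m := by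
    rw [map_sub, map_smul, hB.diagonalAction_one r h1]
    rfl
  rw [hB.mulTensorAction_coaction, add_sub_right_comm, h2]
  refine add_mem (apply_mem_augmentationSpan _ ?_ trivial)
    (apply_mem_augmentationSpan _ (counit_proj_one hB b) trivial)
  simp [counit_proj_zero, HopfSuperalgebra.counit_one (𝒜 := 𝒜)]

/-- In the fibre `(A ⊗ Y) / (A ⊗ Y) B⁺`, the classes of `a ⊗ y b` and of `S(b) a ⊗ y` agree. -/
theorem tmul_sub_antipode_mul_mem_augmentationSpan (hA : IsSuperCommutative 𝒜)
    (hB : IsLeftCoidealSupersubalgebra 𝒜 B) {r : B →ₗ[K] Module.End K Y} (h1 : r 1 = 1)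
    (b : B) (a : A) (y : Y) :
    a ⊗ₜ[K] r b y - (HopfSuperalgebra.antipode 𝒜 (b : A) * a) ⊗ₜ[K] y ∈
      augmentationSpan (hB.diagonalAction r) ⊤ := by
  -- On the iterated coaction of `b`, `G` gives `∑ b₂ S(b₁) a ⊗ y b₃`. Contracting `b₂ S(b₁)` yields
  -- `a ⊗ y b`; letting the last two factors act through the counit modulo `B⁺` yields `S(b) a ⊗ y`.
  let G : A ⊗[K] (A ⊗[K] B) →ₗ[K] A ⊗[K] Y := TensorProduct.lift
    (LinearMap.flip (mulTensorAction r) ∘ₗ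
      (TensorProduct.mk K A Y).flip y ∘ₗ LinearMap.mulRight K a ∘ₗ HopfSuperalgebra.antipode 𝒜)
  have hG : ∀ x t, G (x ⊗ₜ t) =
      mulTensorAction r t ((HopfSuperalgebra.antipode 𝒜 x * a) ⊗ₜ y) := fun x t => by simp [G]
  have hleft : ∀ t : A ⊗[K] B, G (TensorProduct.assoc K A A B ((superComul 𝒜).rTensor B t)) =
      a ⊗ₜ r (TensorProduct.lid K B ((Coalgebra.counit (R := K)).rTensor B t)) y := by
    intro t
    induction t with
    | zero => simp
    | add s t hs ht => simp only [map_add, hs, ht, LinearMap.add_apply, TensorProduct.tmul_add]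
    | tmul x c =>
      have h2 : ∀ t : A ⊗[K] A, G (TensorProduct.assoc K A A B (t ⊗ₜ c)) =
          (LinearMap.mul' K A (TensorProduct.comm K A A
            ((HopfSuperalgebra.antipode 𝒜).rTensor A t)) * a) ⊗ₜ r c y := by
        intro t
        induction t with
        | zero => simp
        | add s t hs ht => simp only [map_add, TensorProduct.add_tmul, add_mul, hs, ht]
        | tmul x x' => simp [hG, mul_assoc]
      rw [LinearMap.rTensor_tmul, h2, mul_comm_antipode_superComul hA]
      simp [Algebra.algebraMap_eq_smul_one, TensorProduct.smul_tmul]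
  have hright : ∀ t : A ⊗[K] B, G (hB.coaction.lTensor A t) -
      (HopfSuperalgebra.antipode 𝒜 (TensorProduct.rid K A
        ((Coalgebra.counit (R := K) ∘ₗ B.val.toLinearMap).lTensor A t)) * a) ⊗ₜ y ∈
      augmentationSpan (hB.diagonalAction r) ⊤ := by
    intro t
    induction t with
    | zero => simp
    | add s t hs ht =>
      simp only [map_add, add_mul, TensorProduct.add_tmul]
      rw [add_sub_add_comm]
      exact add_mem hs ht
    | tmul x c =>
      have := mulTensorAction_sub_mem_augmentationSpan hB h1 c
        ((HopfSuperalgebra.antipode 𝒜 x * a) ⊗ₜ y)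
      simpa [hG, TensorProduct.smul_tmul'] using this
  have := hright (hB.coaction b)
  rw [← hB.coaction_coassoc, hleft, hB.rTensor_counit_coaction, hB.lTensor_counit_coaction] at this
  simpa using this

end Fibre

/-! ### Identification of `X ⊗_B A` with the fibre, and flatness -/

section Flatness

variable {K : Type*} [Field K] {A : Type*} [Ring A] [Algebra K A]
  {𝒜 : ZMod 2 → Submodule K A} [GradedAlgebra 𝒜] [Coalgebra K A] [HopfSuperalgebra 𝒜]
  {B : Subalgebra K A}
  {X : Type*} [AddCommGroup X] [Module K X] [Module Bᵐᵒᵖ X] [IsScalarTower K Bᵐᵒᵖ X]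
  {Y : Type*} [AddCommGroup Y] [Module K Y] [Module Bᵐᵒᵖ Y] [IsScalarTower K Bᵐᵒᵖ Y]

variable (X) in
/-- The right action of `B` on a right `B`-module. -/
noncomputable def rightAction : B →ₗ[K] Module.End K X :=
  (Algebra.lsmul K K X : Bᵐᵒᵖ →ₐ[K] Module.End K X).toLinearMap ∘ₗ
    (MulOpposite.opLinearEquiv K).toLinearMap

omit [Coalgebra K A] in
theorem rightAction_apply (b : B) (x : X) : rightAction X b x = MulOpposite.op b • x := rfl

omit [Coalgebra K A] in
variable (B X) in
theorem rightAction_one : rightAction X (1 : B) = 1 := LinearMap.ext fun x => one_smul Bᵐᵒᵖ x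

omit [Coalgebra K A] [Module K X] [IsScalarTower K Bᵐᵒᵖ X] in
theorem balancedTensor_mk_smul_tmul (b : B) (x : X) (a : A) :
    (QuotientAddGroup.mk ((MulOpposite.op b • x) ⊗ₜ[ℤ] a) : BalancedTensor B X A) =
      QuotientAddGroup.mk (x ⊗ₜ[ℤ] ((b : A) * a)) := by
  rw [← sub_eq_zero, ← QuotientAddGroup.mk_sub, QuotientAddGroup.eq_zero_iff]
  exact AddSubgroup.subset_closure ⟨x, b, a, rfl⟩

variable (𝒜 X) in
/-- The map `x ⊗ a ↦ S(a) ⊗ x`. -/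
noncomputable def balancedToFibre : X ⊗[ℤ] A →+ A ⊗[K] X :=
  TensorProduct.liftAddHom
    (AddMonoidHom.mk' (fun x => AddMonoidHom.mk' (fun a => HopfSuperalgebra.antipode 𝒜 a ⊗ₜ[K] x)
      fun a a' => by rw [map_add, TensorProduct.add_tmul])
      fun x x' => by ext a; exact TensorProduct.tmul_add _ _ _)
    fun n x a => by
      simp only [AddMonoidHom.mk'_apply, map_zsmul]
      rfl

@[simp] theorem balancedToFibre_tmul (x : X) (a : A) :
    balancedToFibre 𝒜 X (x ⊗ₜ a) = HopfSuperalgebra.antipode 𝒜 a ⊗ₜ x := rfl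

variable (𝒜 B X) in
/-- The map `a ⊗ x ↦ x ⊗ S(a)`. -/
noncomputable def fibreToBalanced : A ⊗[K] X →+ BalancedTensor B X A :=
  TensorProduct.liftAddHom
    (AddMonoidHom.mk' (fun a => AddMonoidHom.mk' (fun x =>
      (QuotientAddGroup.mk (x ⊗ₜ[ℤ] HopfSuperalgebra.antipode 𝒜 a) : BalancedTensor B X A))
      fun x x' => by rw [TensorProduct.add_tmul, QuotientAddGroup.mk_add])
      fun a a' => by
        ext x
        simp [TensorProduct.tmul_add])
    fun c a x => by
      have := balancedTensor_mk_smul_tmul (algebraMap K B c) x (HopfSuperalgebra.antipode 𝒜 a)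
      have hc : MulOpposite.op (algebraMap K B c) • x = c • x := by
        rw [← MulOpposite.algebraMap_apply, algebraMap_smul]
      rw [hc] at this
      simp only [AddMonoidHom.mk'_apply, map_smul, this]
      rw [Algebra.smul_def]
      rfl

@[simp] theorem fibreToBalanced_tmul (a : A) (x : X) :
    fibreToBalanced 𝒜 B X (a ⊗ₜ x) =
      QuotientAddGroup.mk (x ⊗ₜ[ℤ] HopfSuperalgebra.antipode 𝒜 a) := rfl

theorem fibreToBalanced_balancedToFibre (hA : IsSuperCommutative 𝒜) (t : X ⊗[ℤ] A) :
    fibreToBalanced 𝒜 B X (balancedToFibre 𝒜 X t) = QuotientAddGroup.mk t := by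
  induction t with
  | zero => simp
  | add s t hs ht => rw [map_add, map_add, hs, ht, QuotientAddGroup.mk_add]
  | tmul x a => rw [balancedToFibre_tmul, fibreToBalanced_tmul, antipode_antipode hA]

theorem balancedToFibre_mem (hA : IsSuperCommutative 𝒜) (hB : IsLeftCoidealSupersubalgebra 𝒜 B)
    {t : X ⊗[ℤ] A} (ht : t ∈ balancedRelations B X A) :
    balancedToFibre 𝒜 X t ∈ augmentationSpan (hB.diagonalAction (rightAction X)) ⊤ := by
  induction ht using AddSubgroup.closure_induction with
  | mem t ht =>
    obtain ⟨x, b, a, rfl⟩ := ht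
    have := tmul_sub_antipode_mul_mem_augmentationSpan hA hB (r := rightAction X)
      (rightAction_one B X) b
      (HopfSuperalgebra.antipode 𝒜 a) x
    rw [← antipode_mul hA] at this
    rwa [map_sub]
  | zero => simp
  | add s t _ _ hs ht => rw [map_add]; exact add_mem hs ht
  | neg t _ ht => rw [map_neg]; exact neg_mem ht

/-- In `X ⊗_B A` one has `∑ x b₂ ⊗ S(b₁ a) = x ⊗ ∑ b₂ S(b₁) S(a) = ε(b) x ⊗ S(a)`, which vanishes
when `ε(b) = 0`. -/
theorem fibreToBalanced_eq_zero (hA : IsSuperCommutative 𝒜)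
    (hB : IsLeftCoidealSupersubalgebra 𝒜 B) {t : A ⊗[K] X}
    (ht : t ∈ augmentationSpan (hB.diagonalAction (rightAction X)) ⊤) :
    fibreToBalanced 𝒜 B X t = 0 := by
  have h1 : ∀ (s : A ⊗[K] B) (a : A) (x : X),
      fibreToBalanced 𝒜 B X (mulTensorAction (rightAction X) s (a ⊗ₜ x)) =
        QuotientAddGroup.mk (x ⊗ₜ[ℤ] (LinearMap.mul' K A (TensorProduct.comm K A A
          ((HopfSuperalgebra.antipode 𝒜).rTensor A (B.val.toLinearMap.lTensor A s))) *
            HopfSuperalgebra.antipode 𝒜 a)) := by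
    intro s a x
    induction s with
    | zero => simp
    | add s t hs ht =>
      simp only [map_add, LinearMap.add_apply, hs, ht, add_mul, TensorProduct.tmul_add,
        QuotientAddGroup.mk_add]
    | tmul y c =>
      rw [mulTensorAction_tmul, fibreToBalanced_tmul, rightAction_apply,
        balancedTensor_mk_smul_tmul, antipode_mul hA]
      simp [mul_assoc]
  have h2 : ∀ b : B, Coalgebra.counit (R := K) (b : A) = 0 → ∀ m : A ⊗[K] X,
      fibreToBalanced 𝒜 B X (mulTensorAction (rightAction X) (hB.coaction b) m) = 0 := by
    intro b hb m
    induction m with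
    | zero => simp
    | add m m' h h' => rw [map_add, map_add, h, h', add_zero]
    | tmul a x =>
      rw [h1, hB.lTensor_coaction, mul_comm_antipode_superComul hA, hb]
      simp
  refine augmentationSpan_induction (P := fun t => fibreToBalanced 𝒜 B X t = 0) ht (map_zero _)
    ?_ ?_
  · intro b m _ hb
    rw [← hB.proj_zero_add_proj_one b, map_add, LinearMap.add_apply, map_add,
      hB.diagonalAction_apply _ (proj_mem 0 _), hB.diagonalAction_apply _ (proj_mem 1 _),
      h2 _ ((counit_proj_zero hB b).trans hb), h2 _ (counit_proj_one hB b), add_zero]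
  · intro s t hs ht
    rw [map_add, hs, ht, add_zero]

theorem fibreToBalanced_lTensor (f : X →ₗ[K] Y) (f' : X →ₗ[Bᵐᵒᵖ] Y) (hf : ∀ x, f x = f' x)
    (t : A ⊗[K] X) :
    fibreToBalanced 𝒜 B Y (f.lTensor A t) =
      BalancedTensor.map B A f' (fibreToBalanced 𝒜 B X t) := by
  induction t with
  | zero => simp
  | add s t hs ht => simp only [map_add, hs, ht]
  | tmul a x =>
    rw [LinearMap.lTensor_tmul, fibreToBalanced_tmul, fibreToBalanced_tmul, hf]
    rfl

theorem balancedToFibre_rTensor (f : X →ₗ[K] Y) (f' : X →+ Y) (hf : ∀ x, f x = f' x)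
    (t : X ⊗[ℤ] A) :
    balancedToFibre 𝒜 Y (LinearMap.rTensor A f'.toIntLinearMap t) =
      f.lTensor A (balancedToFibre 𝒜 X t) := by
  induction t with
  | zero => simp
  | add s t hs ht => simp only [map_add, hs, ht]
  | tmul x a => simp [hf]

theorem balancedTensor_map_exact (hA : IsSuperCommutative 𝒜) (hK : (2 : K) ≠ 0)
    (hB : IsLeftCoidealSupersubalgebra 𝒜 B)
    {Z : Type*} [AddCommGroup Z] [Module K Z] [Module Bᵐᵒᵖ Z] [IsScalarTower K Bᵐᵒᵖ Z]
    (f : X →ₗ[Bᵐᵒᵖ] Y) (g : Y →ₗ[Bᵐᵒᵖ] Z) (hfg : Function.Exact f g) :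
    Function.Exact (BalancedTensor.map B A f) (BalancedTensor.map B A g) := by
  intro ξ
  obtain ⟨τ, rfl⟩ := QuotientAddGroup.mk_surjective ξ
  constructor
  · intro h
    have h1 : LinearMap.rTensor A g.toAddMonoidHom.toIntLinearMap τ ∈ balancedRelations B Z A :=
      (QuotientAddGroup.eq_zero_iff _).1 h
    have h2 := balancedToFibre_mem hA hB h1
    rw [balancedToFibre_rTensor (g.restrictScalars K) _ (fun _ => rfl)] at h2
    obtain ⟨x, t', ht', hx⟩ := hB.exact_fibre hA hK (r := rightAction Y) (r' := rightAction Z)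
      (f := f.restrictScalars K) (g := g.restrictScalars K) (rightAction_one B Z)
      (fun b c => LinearMap.ext fun z => mul_smul (MulOpposite.op c) (MulOpposite.op b) z) hfg
      (fun b y => g.map_smul (MulOpposite.op b) y) h2
    -- The decomposition found in the fibre is carried back; its part in the augmentation span
    -- becomes zero.
    refine ⟨fibreToBalanced 𝒜 B X x, ?_⟩
    rw [← fibreToBalanced_balancedToFibre hA, hx, map_add, fibreToBalanced_eq_zero hA hB ht',
      add_zero, fibreToBalanced_lTensor _ f fun _ => rfl]
  · rintro ⟨η, hη⟩
    obtain ⟨t, rfl⟩ := QuotientAddGroup.mk_surjective η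
    rw [← hη]
    change (QuotientAddGroup.mk (LinearMap.rTensor A g.toAddMonoidHom.toIntLinearMap
      (LinearMap.rTensor A f.toAddMonoidHom.toIntLinearMap t)) : BalancedTensor B Z A) = 0
    have h0 : g.toAddMonoidHom.toIntLinearMap ∘ₗ f.toAddMonoidHom.toIntLinearMap = 0 :=
      LinearMap.ext fun x => hfg.apply_apply_eq_zero x
    rw [← LinearMap.rTensor_comp_apply, h0, LinearMap.rTensor_zero]
    rfl

end Flatness

theorem theorem5p1 {K : Type u} [Field K] (hK : ringChar K ≠ 2)
    {A : Type v} [Ring A] [Algebra K A] (𝒜 : ZMod 2 → Submodule K A) [GradedAlgebra 𝒜]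
    [Coalgebra K A] [HopfSuperalgebra 𝒜] (hA : IsSuperCommutative 𝒜)
    (B : Subalgebra K A) (hB : IsLeftCoidealSupersubalgebra 𝒜 B) :
    IsFlatLeftModule.{v, v, w} B A := by
  intro X Y Z _ _ _ _ _ _ f g hfg
  -- The right `B`-modules come without a `K`-structure; they acquire it through `K → Bᵐᵒᵖ`, which
  -- makes every `B`-linear map `K`-linear.
  let _ : Module K X := Module.compHom X (algebraMap K Bᵐᵒᵖ)
  let _ : Module K Y := Module.compHom Y (algebraMap K Bᵐᵒᵖ)
  let _ : Module K Z := Module.compHom Z (algebraMap K Bᵐᵒᵖ)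
  have : IsScalarTower K Bᵐᵒᵖ X := IsScalarTower.of_algebraMap_smul fun _ _ => rfl
  have : IsScalarTower K Bᵐᵒᵖ Y := IsScalarTower.of_algebraMap_smul fun _ _ => rfl
  have : IsScalarTower K Bᵐᵒᵖ Z := IsScalarTower.of_algebraMap_smul fun _ _ => rfl
  exact balancedTensor_map_exact hA (Ring.two_ne_zero hK) hB f g hfg
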